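/- Let $\Delta\ge 3$. A finite $\Delta$-regular tree is a finite tree $T$ of maximum degree at most $\Delta$ in which every vertex $v$ of degree $d$ is contained in $\Delta$ half-edges: the $d$ real half-edges $(v,e)$, with $e$ an edge at $v$, and $\Delta-d$ virtual half-edges. An LCL is a triple $\Pi=(\Sigma,\mathcal V,\mathcal E)$, where $\Sigma$ is a finite set of labels, $\mathcal V$ is a set of cardinality-$\Delta$ multisets of labels, and $\mathcal E$ is a set of cardinality-$2$ multisets of labels. A labeling of all (real and virtual) half-edges of $T$ by elements of $\Sigma$ is a correct solution of $\Pi$ if the multiset of labels on the half-edges around each vertex belongs to $\mathcal V$ and the multiset of the two labels on each edge belongs to $\mathcal E$. A deterministic local algorithm of local complexity $t(n)$ is a function that maps the number of vertices $n$ together with the isomorphism type of the radius-$t(n)$ neighborhood of a vertex $u$, rooted at $u$ and equipped with the identifiers of its vertices, to a label for each half-edge at $u$. The LCL $\Pi$ is solvable in $\mathsf{LOCAL}(n^{o(1)})$ rounds if there are a function $t:\mathbb N\to\mathbb N$ with $t(n)=n^{o(1)}$ (for every $\varepsilon>0$, $t(n)\le n^{\varepsilon}$ for all sufficiently large $n$),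 a constant integer $C\ge 1$ and a deterministic local algorithm of local complexity $t(n)$ that returns a correct solution of $\Pi$ on every finite $\Delta$-regular tree, where $n$ is its number of vertices, for every assignment of distinct identifiers from $\{1,\dots,n^{C}\}$ to its vertices. For $\ell\ge 2$, a set $\mathcal V'\subseteq\mathcal V$ is $\ell$-full if the following holds for every path with $k\ge\ell$ vertices, to which virtual half-edges are added so that each vertex has $\Delta$ half-edges: whenever the half-edges around the two endpoints are labeled arbitrarily so that the multisets of labels around them are in $\mathcal V'$, the half-edges around the remaining $k-2$ vertices can be labeled with configurations from $\mathcal V'$ so that the pair of labels on each of the $k-1$ edges of the path is in $\mathcal E$. Theorem. If an LCL $\Pi=(\Sigma,\mathcal V,\mathcal E)$ on $\Delta$-regular trees is solvable in (deterministic) $\mathsf{LOCAL}(n^{o(1)})$ rounds, then there exists a non-empty $\ell$-full set $\mathcal V'\subseteq\mathcal V$ for some $\ell\ge 2$. -/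

import Mathlib

namespace RegTreeLCL

/-- An LCL on `Δ`-regular trees with label set `Λ`: a set of multisets of labels of
cardinality `Δ` (vertex configurations) and a set of unordered pairs of labels
(edge configurations). -/
structure LCL (Δ : ℕ) (Λ : Type*) where
  vertexConfigs : Set (Multiset Λ)
  card_of_mem : ∀ m ∈ vertexConfigs, Multiset.card m = Δ
  edgeConfigs : Set (Sym2 Λ)

section HalfEdges

variable {V : Type*} [Fintype V]

/-- A finite `Δ`-regular tree: a finite tree of maximum degree at most `Δ`. The missing virtual
half-edges are supplied by `HalfEdgeAt`. -/
def IsRegularTree (Δ : ℕ) (G : SimpleGraph V) [DecidableRel G.Adj] : Prop :=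
  G.IsTree ∧ ∀ v, G.degree v ≤ Δ

/-- The half-edges at the vertex `v`: one real half-edge for each neighbour `w` of `v` (standing
for `(v, {v, w})`), and `Δ - deg v` virtual half-edges. -/
abbrev HalfEdgeAt (Δ : ℕ) (G : SimpleGraph V) [DecidableRel G.Adj] (v : V) : Type _ :=
  G.neighborSet v ⊕ Fin (Δ - G.degree v)

/-- A labeling of all half-edges, real and virtual. -/
abbrev HalfEdgeLabeling (Δ : ℕ) (G : SimpleGraph V) [DecidableRel G.Adj] (Λ : Type*) : Type _ :=
  ∀ v : V, HalfEdgeAt Δ G v → Λ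

variable {Δ : ℕ} {Λ : Type*} {G : SimpleGraph V} [DecidableRel G.Adj]

/-- The multiset of labels on the half-edges at `v`. -/
def configAt (c : HalfEdgeLabeling Δ G Λ) (v : V) : Multiset Λ :=
  (Finset.univ : Finset (HalfEdgeAt Δ G v)).val.map (c v)

/-- The unordered pair of labels on the two half-edges of the edge `{u, v}`. -/
def edgeConfig (c : HalfEdgeLabeling Δ G Λ) {u v : V} (h : G.Adj u v) : Sym2 Λ :=
  s(c u (Sum.inl ⟨v, h⟩), c v (Sum.inl ⟨u, h.symm⟩))

/-- Correct solutions of an LCL. -/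
def IsSolution (P : LCL Δ Λ) (c : HalfEdgeLabeling Δ G Λ) : Prop :=
  (∀ v, configAt c v ∈ P.vertexConfigs) ∧
    ∀ (u v : V) (h : G.Adj u v), edgeConfig c h ∈ P.edgeConfigs

end HalfEdges

section Local

/-- A rooted graph whose vertices are natural numbers. It serves as the canonical representative
of the isomorphism type of a rooted graph with distinct natural number identifiers: every vertex
is replaced by its identifier. -/
structure View where
  root : ℕ
  verts : Set ℕ
  edges : Set (Sym2 ℕ)

/-- The isomorphism type of the radius-`t` neighbourhood of `v` (the subgraph induced on the
vertices at distance at most `t`), rooted at `v`, with identifiers. -/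
def viewAt {V : Type*} (G : SimpleGraph V) (ident : V → ℕ) (t : ℕ) (v : V) : View where
  root := ident v
  verts := {i | ∃ a, G.dist v a ≤ t ∧ ident a = i}
  edges := {e | ∃ a b, G.dist v a ≤ t ∧ G.dist v b ≤ t ∧ G.Adj a b ∧ e = s(ident a, ident b)}

/-- A deterministic local algorithm: a function of the size `n` of the graph and of the
neighbourhood of a vertex `v`, whose value gives a label to every half-edge at `v`. The real
half-edge towards a neighbour is referred to by the identifier of this neighbour (`Sum.inl`), the
virtual half-edges are referred to by their index (`Sum.inr`). -/
abbrev LocalAlgorithm (Λ : Type*) : Type _ := ℕ → View → ℕ ⊕ ℕ → Λ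

/-- The half-edge labeling produced by the algorithm `A` with local complexity `t`. -/
def LocalAlgorithm.run {Λ : Type*} (A : LocalAlgorithm Λ) (t : ℕ → ℕ) (Δ : ℕ)
    {V : Type*} [Fintype V] (G : SimpleGraph V) [DecidableRel G.Adj] (ident : V → ℕ) :
    HalfEdgeLabeling Δ G Λ :=
  fun v h =>
    A (Fintype.card V) (viewAt G ident (t (Fintype.card V)) v)
      (Sum.map (fun w : G.neighborSet v => ident w) (fun i : Fin (Δ - G.degree v) => (i : ℕ)) h)

/-- `P` has deterministic local complexity `t` on finite `Δ`-regular trees: for some constant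
`C ≥ 1`, some local algorithm of local complexity `t` returns a correct solution on every finite
`Δ`-regular tree with `n` vertices, for every assignment of distinct identifiers from
`{1, …, n ^ C}`. -/
def HasLocalComplexity {Δ : ℕ} {Λ : Type*} (P : LCL Δ Λ) (t : ℕ → ℕ) : Prop :=
  ∃ C : ℕ, 1 ≤ C ∧ ∃ A : LocalAlgorithm Λ,
    ∀ (V : Type) [Fintype V] (G : SimpleGraph V) [DecidableRel G.Adj],
      IsRegularTree Δ G →
      ∀ ident : V → ℕ, Function.Injective ident →
        (∀ v, ident v ∈ Finset.Icc 1 (Fintype.card V ^ C)) →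
        IsSolution P (A.run t Δ G ident)

/-- `t(n) = n ^ o(1)`: for every `ε > 0`, `t(n) ≤ n ^ ε` for all sufficiently large `n`. -/
def IsSubpolynomial (t : ℕ → ℕ) : Prop :=
  ∀ ε : ℝ, 0 < ε → ∀ᶠ n : ℕ in Filter.atTop, (t n : ℝ) ≤ (n : ℝ) ^ ε

/-- The class `LOCAL(n ^ o(1))` (deterministic). -/
def InLocalSubpolynomial {Δ : ℕ} {Λ : Type*} (P : LCL Δ Λ) : Prop :=
  ∃ t : ℕ → ℕ, IsSubpolynomial t ∧ HasLocalComplexity P t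

end Local

instance pathGraphDecidableAdj (k : ℕ) : DecidableRel (SimpleGraph.pathGraph k).Adj :=
  fun _ _ => decidable_of_iff _ SimpleGraph.pathGraph_adj.symm

/-- `S` is an `ℓ`-full set of vertex configurations of `P` (for `ℓ ≥ 2`). The path has
`m + 2 ≥ ℓ` vertices `0, …, m + 1`; each of them gets half-edges up to degree `Δ`. Of the
labeling `c₀` only the part around the two endpoints is used: it is an arbitrary labeling of
their half-edges with configurations from `S`. -/
def IsFull {Δ : ℕ} {Λ : Type*} (P : LCL Δ Λ) (S : Set (Multiset Λ)) (ℓ : ℕ) : Prop :=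
  S ⊆ P.vertexConfigs ∧
    ∀ m : ℕ, ℓ ≤ m + 2 →
      ∀ c₀ : HalfEdgeLabeling Δ (SimpleGraph.pathGraph (m + 2)) Λ,
        configAt c₀ 0 ∈ S → configAt c₀ (Fin.last (m + 1)) ∈ S →
        ∃ c : HalfEdgeLabeling Δ (SimpleGraph.pathGraph (m + 2)) Λ,
          c 0 = c₀ 0 ∧ c (Fin.last (m + 1)) = c₀ (Fin.last (m + 1)) ∧
          (∀ v, configAt c v ∈ S) ∧
          ∀ (u v : Fin (m + 2)) (h : (SimpleGraph.pathGraph (m + 2)).Adj u v),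
            edgeConfig c h ∈ P.edgeConfigs

end RegTreeLCL

/-! Fix a large `n` and run the algorithm, told that there are `n` vertices, on finite subtrees of
the infinite edge-coloured regular tree. A smaller subtree can be padded to `n` vertices out of
sight of the vertices of interest, so their configurations are valid. `coreConfigs` collects the
configurations seen at a vertex whose `i`-th `core` lies in a subtree with at most `N` vertices; it
shrinks with `i` and grows with `N`.

The main step is `linkable_coreConfigs`. Two configurations of level `i + 1` are realized at the
ends of a long path leaving along prescribed half-edges. Near its ends the path follows the
alternating paths built into the cores, so its vertices there already have their `i`-th cores; the
cores of the other path vertices are added and are too far away to change the views at the ends. All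
inner vertices are thus of level `i` in a somewhat larger tree. The two end subtrees may reuse
identifiers, so two identifier assignments are used that differ only near the ends, and the labeling
switches between them at a vertex that sees no difference.

Lowering `i` while enlarging `N` gives an increasing chain in the finite set of vertex
configurations, so two consecutive sets coincide (`exists_eq_succ_of_bounded`). The end and inner
configurations then come from the same set, and `linkable_of_bounded` passes from a bounded range of
path lengths to all large ones. The number of levels is constant and the sizes are polynomial in `t
n`, so a suitable `n` exists (`IsSubpolynomial.exists_le`). -/

namespace RegTreeLCL

/-! ### The infinite regular tree and its colour-preserving maps -/

/-- Words over `Fin Δ` without two equal consecutive letters: the vertices of the infinite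
`Δ`-regular tree with a proper edge colouring. The last traversed edge is the head of the word. -/
abbrev Word (Δ : ℕ) : Type := {w : List (Fin Δ) // w.IsChain (· ≠ ·)}

namespace Word

variable {Δ : ℕ}

/-- The root of the tree. -/
def nil : Word Δ := ⟨[], List.isChain_nil⟩

/-- The length of a word, that is, the depth of the vertex. -/
def len (x : Word Δ) : ℕ := x.1.length

/-- The neighbour of `x` along the edge of colour `α`. -/
def step (α : Fin Δ) (x : Word Δ) : Word Δ :=
  if h : x.1.head? = some α then ⟨x.1.tail, x.2.tail⟩
  else ⟨α :: x.1, by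
    rcases x with ⟨_ | ⟨b, l⟩, hx⟩
    · simp
    · simp only [List.head?_cons, Option.some.injEq] at h
      exact List.isChain_cons_cons.2 ⟨fun e => h e.symm, hx⟩⟩

theorem step_of_head {α : Fin Δ} {x : Word Δ} (h : x.1.head? = some α) :
    (step α x).1 = x.1.tail := by
  simp [step, h]

theorem step_of_not_head {α : Fin Δ} {x : Word Δ} (h : x.1.head? ≠ some α) :
    (step α x).1 = α :: x.1 := by
  simp [step, h]

theorem cons_eq_of_head {α : Fin Δ} {x : Word Δ} (h : x.1.head? = some α) :
    α :: (step α x).1 = x.1 := by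
  rw [step_of_head h]
  rcases x with ⟨_ | ⟨b, l⟩, hx⟩
  · simp at h
  · simp at h
    simp [h]

theorem head_step_ne {α : Fin Δ} {x : Word Δ} (h : x.1.head? = some α) :
    (step α x).1.head? ≠ some α := by
  have h1 := cons_eq_of_head h
  have h2 := x.2
  rw [← h1] at h2
  intro h3
  cases h4 : (step α x).1 with
  | nil => simp [h4] at h3
  | cons b l =>
    rw [h4] at h2 h3
    simp at h3
    exact (List.isChain_cons_cons.1 h2).1 h3.symm

@[simp] theorem step_step (α : Fin Δ) (x : Word Δ) : step α (step α x) = x := by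
  by_cases h : x.1.head? = some α
  · exact Subtype.ext (by rw [step_of_not_head (head_step_ne h), cons_eq_of_head h])
  · refine Subtype.ext ?_
    have h1 := step_of_not_head h
    rw [step_of_head (by rw [h1]; rfl), h1]
    rfl

theorem len_step_of_not_head {α : Fin Δ} {x : Word Δ} (h : x.1.head? ≠ some α) :
    (step α x).len = x.len + 1 := by
  simp [len, step_of_not_head h]

theorem len_step_of_head {α : Fin Δ} {x : Word Δ} (h : x.1.head? = some α) :
    (step α x).len + 1 = x.len := by
  have := congrArg List.length (cons_eq_of_head h)
  simpa [len] using this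

theorem len_step_le (α : Fin Δ) (x : Word Δ) : (step α x).len ≤ x.len + 1 := by
  by_cases h : x.1.head? = some α
  · have := len_step_of_head h; omega
  · exact (len_step_of_not_head h).le

theorem step_ne (α : Fin Δ) (x : Word Δ) : step α x ≠ x := by
  intro h
  by_cases h' : x.1.head? = some α
  · have := len_step_of_head h'; rw [h] at this; omega
  · have := len_step_of_not_head h'; rw [h] at this; omega

theorem step_left_injective (x : Word Δ) : Function.Injective fun α => step α x := by
  have key : ∀ α β : Fin Δ, x.1.head? = some α → step α x = step β x → α = β := by
    intro α β ha h
    by_cases hb : x.1.head? = some β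
    · exact Option.some.inj (ha.symm.trans hb)
    · have h1 := len_step_of_head ha
      have h2 := len_step_of_not_head hb
      rw [h] at h1; omega
  intro α β (h : step α x = step β x)
  by_cases ha : x.1.head? = some α
  · exact key α β ha h
  by_cases hb : x.1.head? = some β
  · exact (key β α hb h.symm).symm
  · have := congrArg Subtype.val h
    rw [step_of_not_head ha, step_of_not_head hb] at this
    exact (List.cons.inj this).1

/-- The infinite `Δ`-regular tree. -/
def tree (Δ : ℕ) : SimpleGraph (Word Δ) where
  Adj x y := ∃ α, y = step α x
  symm := ⟨by rintro x y ⟨α, rfl⟩; exact ⟨α, (step_step α x).symm⟩⟩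
  loopless := ⟨by rintro x ⟨α, h⟩; exact step_ne α x h.symm⟩

theorem adj_step (α : Fin Δ) (x : Word Δ) : (tree Δ).Adj x (step α x) := ⟨α, rfl⟩

theorem eq_cons_or_of_adj {x y : Word Δ} (h : (tree Δ).Adj x y) :
    (∃ α, y.1 = α :: x.1) ∨ ∃ α, x.1 = α :: y.1 := by
  obtain ⟨α, rfl⟩ := h
  by_cases h : x.1.head? = some α
  · exact Or.inr ⟨α, (cons_eq_of_head h).symm⟩
  · exact Or.inl ⟨α, step_of_not_head h⟩

/-- Every edge joins a word to a one-letter extension `y`. Without that edge no walk can leave the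
set of words with suffix `y`, so the edge is a bridge. -/
theorem isAcyclic_tree : (tree Δ).IsAcyclic := by
  rw [SimpleGraph.isAcyclic_iff_forall_adj_isBridge]
  have key : ∀ x y : Word Δ, ∀ α, y.1 = α :: x.1 →
      ¬ ((tree Δ).deleteEdges {s(x, y)}).Reachable y x := by
    rintro x y α hxy ⟨p⟩
    have inv : ∀ a b : Word Δ, ((tree Δ).deleteEdges {s(x, y)}).Walk a b →
        y.1 <:+ a.1 → y.1 <:+ b.1 := by
      intro a b p
      induction p with
      | nil => exact id
      | @cons a c b h p ih =>
        intro ha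
        apply ih
        rw [SimpleGraph.deleteEdges_adj] at h
        rcases eq_cons_or_of_adj h.1 with ⟨β, hβ⟩ | ⟨β, hβ⟩
        · rw [hβ]; exact ha.trans (List.suffix_cons _ _)
        · rw [hβ, List.suffix_cons_iff] at ha
          rcases ha with ha | ha
          · exfalso
            apply h.2
            have h1 : y = a := Subtype.ext (by rw [ha, hβ])
            have h2 : x = c := Subtype.ext (by rw [hxy] at ha; exact (List.cons.inj ha).2)
            rw [h1, h2]; simp [Sym2.eq_swap]
          · exact ha
    have := (inv y x p List.suffix_rfl).length_le
    rw [hxy] at this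
    simp at this
  intro x y hxy
  rcases eq_cons_or_of_adj hxy with ⟨α, h⟩ | ⟨α, h⟩
  · rw [SimpleGraph.isBridge_iff]
    exact fun hr => key x y α h hr.symm
  · rw [SimpleGraph.isBridge_iff]
    refine fun hr => key y x α h ?_
    rwa [Sym2.eq_swap]

/-- Maps of the tree that preserve the edge colouring. -/
def IsColorMap (f : Word Δ → Word Δ) : Prop := ∀ α x, f (step α x) = step α (f x)

theorem eq_step_of_cons {α : Fin Δ} {l : List (Fin Δ)} (h : (α :: l).IsChain (· ≠ ·)) :
    (⟨α :: l, h⟩ : Word Δ) = step α ⟨l, h.tail⟩ := by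
  refine Subtype.ext ?_
  rw [step_of_not_head]
  cases l with
  | nil => simp
  | cons b l =>
    have := (List.isChain_cons_cons.1 h).1
    simpa using this.symm

theorem induction_step {p : Word Δ → Prop} (h0 : p nil) (hs : ∀ α x, p x → p (step α x))
    (x : Word Δ) : p x := by
  obtain ⟨l, hl⟩ := x
  induction l with
  | nil => exact h0
  | cons α l ih => rw [eq_step_of_cons hl]; exact hs _ _ (ih _)

theorem connected_tree : (tree Δ).Connected := by
  have : Nonempty (Word Δ) := ⟨nil⟩
  have h : ∀ x : Word Δ, (tree Δ).Reachable nil x :=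
    induction_step (SimpleGraph.Reachable.refl _)
      fun α x hx => hx.trans (adj_step α x).reachable
  exact ⟨fun x y => (h x).symm.trans (h y)⟩

theorem len_le_add_length {x y : Word Δ} (p : (tree Δ).Walk x y) :
    y.len ≤ x.len + p.length := by
  induction p with
  | nil => simp
  | @cons a b c h p ih =>
    have hb : b.len ≤ a.len + 1 := by
      obtain ⟨α, rfl⟩ := h
      exact len_step_le α a
    rw [SimpleGraph.Walk.length_cons]; omega

theorem len_le_add_dist (x y : Word Δ) : y.len ≤ x.len + (tree Δ).dist x y := by
  obtain ⟨p, hp⟩ := connected_tree.exists_walk_length_eq_dist x y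
  rw [← hp]; exact len_le_add_length p

theorem dist_step_le (α : Fin Δ) (x : Word Δ) : (tree Δ).dist x (step α x) ≤ 1 :=
  (SimpleGraph.dist_eq_one_iff_adj.2 (adj_step α x)).le

theorem IsColorMap.dist_le {f : Word Δ → Word Δ} (hf : IsColorMap f) (x y : Word Δ) :
    (tree Δ).dist (f x) (f y) ≤ (tree Δ).dist x y := by
  obtain ⟨p, hp⟩ := connected_tree.exists_walk_length_eq_dist x y
  rw [← hp]
  let hom : tree Δ →g tree Δ := ⟨f, by rintro a _ ⟨α, rfl⟩; exact ⟨α, hf α a⟩⟩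
  have := SimpleGraph.dist_le (p.map hom)
  rwa [SimpleGraph.Walk.length_map] at this

theorem IsColorMap.eq_id {f : Word Δ → Word Δ} (hf : IsColorMap f) (h0 : f nil = nil)
    (x : Word Δ) : f x = x :=
  induction_step (p := fun x => f x = x) h0 (fun α x hx => by rw [hf, hx]) x

theorem isColorMap_id : IsColorMap (id : Word Δ → Word Δ) := fun _ _ => rfl

/-- The colour-preserving map of the tree that sends the root to `g`. -/
def place (g x : Word Δ) : Word Δ := x.1.foldr step g

theorem isColorMap_place (g : Word Δ) : IsColorMap (place g) := by
  intro α x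
  by_cases h : x.1.head? = some α
  · have h1 : place g x = step α (place g (step α x)) := by
      unfold place
      conv_lhs => rw [← cons_eq_of_head h]
      rfl
    rw [h1, step_step]
  · unfold place
    rw [step_of_not_head h]
    rfl

theorem exists_place_eq (x y : Word Δ) : ∃ g, place g x = y := by
  revert y
  refine induction_step (p := fun x => ∀ y, ∃ g, place g x = y) (fun y => ⟨y, rfl⟩) ?_ x
  intro α x ih y
  obtain ⟨g, hg⟩ := ih (step α y)
  exact ⟨g, by rw [isColorMap_place, hg, step_step]⟩

/-- A colour map that fixes the root is the identity, which turns a map bringing the root back into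
a left inverse. Runs of the algorithm can thus be moved to any vertex. -/
theorem exists_colorMap (x y : Word Δ) : ∃ f g : Word Δ → Word Δ,
    IsColorMap f ∧ IsColorMap g ∧ f x = y ∧ Function.LeftInverse g f := by
  obtain ⟨a, ha⟩ := exists_place_eq x y
  obtain ⟨b, hb⟩ := exists_place_eq (place a nil) nil
  refine ⟨place a, place b, isColorMap_place a, isColorMap_place b, ha, ?_⟩
  intro z
  exact IsColorMap.eq_id (f := fun z => place b (place a z))
    (fun α z => by simp only [isColorMap_place a α, isColorMap_place b α]) hb z

/-- The vertex reached from `x` along the colours `e 0, e 1, …, e (j - 1)`. -/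
def walk (e : ℕ → Fin Δ) (x : Word Δ) : ℕ → Word Δ
  | 0 => x
  | j + 1 => step (e j) (walk e x j)

theorem walk_congr {e e' : ℕ → Fin Δ} (x : Word Δ) {j : ℕ} (h : ∀ i < j, e i = e' i) :
    walk e x j = walk e' x j := by
  induction j with
  | zero => rfl
  | succ j ih => simp only [walk]; rw [ih fun i hi => h i (by omega), h j (by omega)]

theorem IsColorMap.walk {f : Word Δ → Word Δ} (hf : IsColorMap f) (e : ℕ → Fin Δ) (x : Word Δ)
    (j : ℕ) : f (walk e x j) = Word.walk e (f x) j := by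
  induction j with
  | zero => rfl
  | succ j ih => simp only [Word.walk]; rw [hf, ih]

theorem dist_walk_le (e : ℕ → Fin Δ) (x : Word Δ) (j : ℕ) :
    (tree Δ).dist x (walk e x j) ≤ j := by
  induction j with
  | zero => simp [walk]
  | succ j ih =>
    have := connected_tree.dist_triangle (u := x) (v := walk e x j) (w := walk e x (j + 1))
    have := dist_step_le (e j) (walk e x j)
    simp only [walk] at *
    omega

/-- A walk that starts away from the root and never repeats a colour immediately cannot turn back.
Exact depths then give lower bounds on distances through `len_le_add_dist`. -/
theorem len_walk {e : ℕ → Fin Δ} {x : Word Δ} {q : ℕ} (h0 : x.1.head? ≠ some (e 0))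
    (he : ∀ j, j + 1 < q → e j ≠ e (j + 1)) {j : ℕ} (hj : j ≤ q) :
    (walk e x j).len = x.len + j := by
  have key : ∀ j ≤ q, (walk e x j).len = x.len + j ∧
      (j < q → (walk e x j).1.head? ≠ some (e j)) := by
    intro j
    induction j with
    | zero => intro _; exact ⟨rfl, fun _ => h0⟩
    | succ j ih =>
      intro hj
      obtain ⟨h1, h2⟩ := ih (by omega)
      have h2 := h2 (by omega)
      refine ⟨?_, fun hq => ?_⟩
      · simp only [walk]; rw [len_step_of_not_head h2, h1]; ring
      · simp only [walk]
        rw [step_of_not_head h2]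
        simpa using he j hq
  exact (key j hj).1

theorem walk_reverse {e f : ℕ → Fin Δ} {x : Word Δ} {q j : ℕ} (hj : j ≤ q)
    (h : ∀ i < j, f i = e (q - 1 - i)) : walk f (walk e x q) j = walk e x (q - j) := by
  induction j with
  | zero => rfl
  | succ j ih =>
    simp only [walk]
    rw [ih (by omega) fun i hi => h i (by omega), h j (by omega)]
    obtain ⟨r, hr⟩ : ∃ r, q - j = r + 1 := ⟨q - j - 1, by omega⟩
    rw [hr, show q - (j + 1) = r by omega, show q - 1 - j = r by omega]
    simp [walk]

end Word

/-! ### Finite subtrees and the algorithm run on them -/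

namespace Word

variable {Δ : ℕ} {Λ : Type*}

theorem IsColorMap.dist_eq {f g : Word Δ → Word Δ} (hf : IsColorMap f) (hg : IsColorMap g)
    (h : Function.LeftInverse g f) (x y : Word Δ) :
    (tree Δ).dist (f x) (f y) = (tree Δ).dist x y := by
  refine le_antisymm (hf.dist_le x y) ?_
  have := hg.dist_le (f x) (f y)
  rwa [h x, h y] at this

/-- A finite set of vertices of the tree that induces a connected subgraph. -/
def IsConn (U : Finset (Word Δ)) : Prop := ((tree Δ).induce (U : Set (Word Δ))).Connected

/-- Paths in an acyclic graph are unique, so a shortest path inside `U` is also shortest in the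
whole tree. -/
theorem IsConn.dist_induce {U : Finset (Word Δ)} (hU : IsConn U) (a b : (U : Set (Word Δ))) :
    ((tree Δ).induce (U : Set (Word Δ))).dist a b = (tree Δ).dist a b := by
  obtain ⟨p, hp, hl⟩ := SimpleGraph.Connected.exists_path_of_dist hU a b
  obtain ⟨q, hq, hl'⟩ := (connected_tree (Δ := Δ)).exists_path_of_dist a b
  let φ : (tree Δ).induce (U : Set (Word Δ)) ↪g tree Δ :=
    SimpleGraph.Embedding.induce (U : Set (Word Δ))
  have hpq : (⟨p.map φ.toHom, hp.map φ.injective⟩ : (tree Δ).Path (a : Word Δ) b) = ⟨q, hq⟩ :=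
    (isAcyclic_tree.subsingleton_path (a : Word Δ) b).elim _ _
  have h3 : p.length = q.length :=
    (SimpleGraph.Walk.length_map φ.toHom p).symm.trans (congrArg (fun r => r.1.length) hpq)
  rw [← hl, ← hl', h3]

theorem IsConn.dist_le_card {U : Finset (Word Δ)} (hU : IsConn U) {a b : Word Δ} (ha : a ∈ U)
    (hb : b ∈ U) : (tree Δ).dist a b ≤ U.card := by
  have h := hU.dist_induce ⟨a, ha⟩ ⟨b, hb⟩
  obtain ⟨p, hp, hl⟩ := SimpleGraph.Connected.exists_path_of_dist hU ⟨a, ha⟩ ⟨b, hb⟩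
  have := hp.length_lt
  rw [hl, h] at this
  simpa using this.le

/-- `y` is reached from `x` by a walk all of whose vertices after `x` lie in `U`. -/
def Reach (U : Finset (Word Δ)) : Word Δ → Word Δ → Prop :=
  Relation.ReflTransGen fun a b => (tree Δ).Adj a b ∧ b ∈ U

theorem Reach.mono {U W : Finset (Word Δ)} (h : U ⊆ W) {x y : Word Δ} (hr : Reach U x y) :
    Reach W x y :=
  Relation.ReflTransGen.mono (fun _ _ hab => ⟨hab.1, h hab.2⟩) _ _ hr

theorem isConn_of_reach {U : Finset (Word Δ)} {v : Word Δ} (hv : v ∈ U)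
    (h : ∀ x ∈ U, Reach U v x) : IsConn U := by
  have key : ∀ x, Reach U v x → ∃ hx : x ∈ U,
      ((tree Δ).induce (U : Set (Word Δ))).Reachable ⟨v, hv⟩ ⟨x, hx⟩ := by
    intro x hx
    induction hx with
    | refl => exact ⟨hv, SimpleGraph.Reachable.refl _⟩
    | tail _ hab ih =>
      obtain ⟨hb, hr⟩ := ih
      refine ⟨hab.2, hr.trans (SimpleGraph.Adj.reachable ?_)⟩
      exact hab.1
  have : Nonempty (U : Set (Word Δ)) := ⟨⟨v, hv⟩⟩
  refine ⟨fun a b => ?_⟩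
  obtain ⟨_, h1⟩ := key a (h a a.2)
  obtain ⟨_, h2⟩ := key b (h b b.2)
  exact h1.symm.trans h2

theorem IsConn.reach {U : Finset (Word Δ)} (hU : IsConn U) {a b : Word Δ} (ha : a ∈ U)
    (hb : b ∈ U) : Reach U a b := by
  obtain ⟨p⟩ := hU.preconnected ⟨a, ha⟩ ⟨b, hb⟩
  have key : ∀ x y : (U : Set (Word Δ)), ((tree Δ).induce (U : Set (Word Δ))).Walk x y →
      Reach U x y := by
    intro x y p
    induction p with
    | nil => exact Relation.ReflTransGen.refl
    | @cons a b c h p ih => exact Relation.ReflTransGen.head ⟨h, b.2⟩ ih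
  exact key _ _ p

/-- The radius-`t` neighbourhood of `v` in the subtree induced on `U`, with identifiers. -/
def view (U : Finset (Word Δ)) (ident : Word Δ → ℕ) (t : ℕ) (v : Word Δ) : View where
  root := ident v
  verts := {i | ∃ a ∈ U, (tree Δ).dist v a ≤ t ∧ ident a = i}
  edges := {e | ∃ a ∈ U, ∃ b ∈ U, (tree Δ).dist v a ≤ t ∧ (tree Δ).dist v b ≤ t ∧
    (tree Δ).Adj a b ∧ e = s(ident a, ident b)}

/-- The label that the algorithm `A` gives to the half-edge of colour `α` at `v`. -/
def output (A : LocalAlgorithm Λ) (n t : ℕ) (U : Finset (Word Δ)) (ident : Word Δ → ℕ)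
    (v : Word Δ) (α : Fin Δ) : Λ :=
  A n (view U ident t v) (Sum.inl (ident (step α v)))

/-- The multiset of labels that the algorithm `A` gives to the half-edges at `v`. -/
def config (A : LocalAlgorithm Λ) (n t : ℕ) (U : Finset (Word Δ)) (ident : Word Δ → ℕ)
    (v : Word Δ) : Multiset Λ :=
  (Finset.univ : Finset (Fin Δ)).val.map (output A n t U ident v)

/-- Agreement is required up to distance `t + 1`, not `t`, because half-edges are named by
identifiers of neighbours, which may lie just outside the view. -/
theorem output_congr (A : LocalAlgorithm Λ) (n t : ℕ) {f g : Word Δ → Word Δ}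
    (hf : IsColorMap f) (hg : IsColorMap g) (hgf : Function.LeftInverse g f)
    {U U' : Finset (Word Δ)} {j j' : Word Δ → ℕ} {v : Word Δ} (hv : v ∈ U')
    (hs : ∀ α, step α v ∈ U')
    (h1 : ∀ a ∈ U', (tree Δ).dist v a ≤ t + 1 → f a ∈ U ∧ j (f a) = j' a)
    (h2 : ∀ a ∈ U, (tree Δ).dist (f v) a ≤ t + 1 → ∃ b ∈ U', f b = a) :
    output A n t U j (f v) = output A n t U' j' v := by
  have hd := hf.dist_eq hg hgf
  have hview : view U j t (f v) = view U' j' t v := by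
    unfold view
    rw [View.mk.injEq]
    refine ⟨(h1 v hv (by simp)).2, ?_, ?_⟩
    · ext i
      constructor
      · rintro ⟨a, ha, hda, rfl⟩
        obtain ⟨b, hb, rfl⟩ := h2 a ha (by omega)
        rw [hd] at hda
        exact ⟨b, hb, hda, (h1 b hb (by omega)).2.symm⟩
      · rintro ⟨a, ha, hda, rfl⟩
        obtain ⟨h3, h4⟩ := h1 a ha (by omega)
        exact ⟨f a, h3, by rwa [hd], h4⟩
    · ext e
      constructor
      · rintro ⟨a, ha, b, hb, hda, hdb, ⟨α, hab⟩, rfl⟩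
        obtain ⟨a, ha', rfl⟩ := h2 a ha (by omega)
        obtain ⟨b, hb', rfl⟩ := h2 b hb (by omega)
        rw [hd] at hda hdb
        refine ⟨a, ha', b, hb', hda, hdb, ⟨α, ?_⟩, ?_⟩
        · rw [← hf] at hab; exact hgf.injective hab
        · rw [(h1 a ha' (by omega)).2, (h1 b hb' (by omega)).2]
      · rintro ⟨a, ha, b, hb, hda, hdb, ⟨α, hab⟩, rfl⟩
        obtain ⟨h3, h4⟩ := h1 a ha (by omega)
        obtain ⟨h5, h6⟩ := h1 b hb (by omega)
        exact ⟨f a, h3, f b, h5, by rwa [hd], by rwa [hd], ⟨α, by rw [hab, hf]⟩, by rw [h4, h6]⟩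
  funext α
  unfold output
  rw [hview, ← hf, (h1 _ (hs α) ((dist_step_le α v).trans (by omega))).2]

theorem output_congr_id (A : LocalAlgorithm Λ) (n t : ℕ) {U U' : Finset (Word Δ)}
    {j j' : Word Δ → ℕ} {v : Word Δ} (hv : v ∈ U') (hs : ∀ α, step α v ∈ U') (hUU' : U' ⊆ U)
    (h1 : ∀ a ∈ U', (tree Δ).dist v a ≤ t + 1 → j a = j' a)
    (h2 : ∀ a ∈ U, (tree Δ).dist v a ≤ t + 1 → a ∈ U') :
    output A n t U j v = output A n t U' j' v :=
  output_congr A n t (f := id) (g := id) isColorMap_id isColorMap_id (fun _ => rfl) hv hs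
    (fun a ha hd => ⟨hUU' ha, h1 a ha hd⟩) fun a ha hd => ⟨a, h2 a ha hd, rfl⟩

end Word

/-- With identifiers up to `n ^ C`, the algorithm `A` of local complexity `t` returns a correct
solution of `P` on all finite `Δ`-regular trees. -/
def LocalAlgorithm.Solves {Δ : ℕ} {Λ : Type*} (A : LocalAlgorithm Λ) (t : ℕ → ℕ) (C : ℕ)
    (P : LCL Δ Λ) : Prop :=
  ∀ (V : Type) [Fintype V] (G : SimpleGraph V) [DecidableRel G.Adj],
    IsRegularTree Δ G →
    ∀ ident : V → ℕ, Function.Injective ident →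
      (∀ v, ident v ∈ Finset.Icc 1 (Fintype.card V ^ C)) →
      IsSolution P (A.run t Δ G ident)

namespace Word

variable {Δ : ℕ} {Λ : Type*}

theorem viewAt_induce {U : Finset (Word Δ)} (hU : IsConn U) (ident : Word Δ → ℕ) (t : ℕ)
    (v : (U : Set (Word Δ))) :
    viewAt ((tree Δ).induce (U : Set (Word Δ))) (fun x => ident x) t v = view U ident t v := by
  unfold viewAt view
  rw [View.mk.injEq]
  refine ⟨rfl, ?_, ?_⟩
  · ext i
    constructor
    · rintro ⟨a, ha, rfl⟩
      exact ⟨a, a.2, by rwa [← hU.dist_induce], rfl⟩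
    · rintro ⟨a, ha, hd, rfl⟩
      exact ⟨⟨a, ha⟩, by rwa [hU.dist_induce], rfl⟩
  · ext i
    constructor
    · rintro ⟨a, b, ha, hb, hab, rfl⟩
      exact ⟨a, a.2, b, b.2, by rwa [← hU.dist_induce], by rwa [← hU.dist_induce], hab, rfl⟩
    · rintro ⟨a, ha, b, hb, hda, hdb, hab, rfl⟩
      exact ⟨⟨a, ha⟩, ⟨b, hb⟩, by rwa [hU.dist_induce], by rwa [hU.dist_induce], hab, rfl⟩

open Classical in
theorem degree_induce_le (U : Finset (Word Δ)) (v : (U : Set (Word Δ))) :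
    ((tree Δ).induce (U : Set (Word Δ))).degree v ≤ Δ := by
  rw [← SimpleGraph.card_neighborSet_eq_degree]
  have : ∀ w : ((tree Δ).induce (U : Set (Word Δ))).neighborSet v,
      ∃ α, (w.1 : Word Δ) = step α v := fun w => w.2
  choose c hc using this
  have hinj : Function.Injective c := by
    intro a b hab
    exact Subtype.ext (Subtype.ext (by rw [hc a, hc b, hab]))
  simpa using Fintype.card_le_of_injective c hinj

/-- Since all neighbours of `v` lie in `U`, there are no virtual half-edges at `v`, and the colours
enumerate its half-edges. -/
theorem config_mem_of_card_eq {P : LCL Δ Λ} {A : LocalAlgorithm Λ} {t : ℕ → ℕ} {C : ℕ}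
    (hC : 1 ≤ C) (hA : A.Solves t C P) {U : Finset (Word Δ)} (hU : IsConn U)
    {ident : Word Δ → ℕ} (hinj : Set.InjOn ident U)
    (hid : ∀ x ∈ U, ident x ∈ Finset.Icc 1 U.card) {v : Word Δ} (hv : v ∈ U)
    (hs : ∀ α, step α v ∈ U) :
    config A U.card (t U.card) U ident v ∈ P.vertexConfigs ∧
      ∀ α, s(output A U.card (t U.card) U ident v α,
        output A U.card (t U.card) U ident (step α v) α) ∈ P.edgeConfigs := by
  classical
  let G := (tree Δ).induce (U : Set (Word Δ))
  let idG : ↥(U : Set (Word Δ)) → ℕ := fun x => ident x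
  have hcard : Fintype.card (U : Set (Word Δ)) = U.card := by simp
  have hsol : IsSolution P (A.run t Δ G idG) := by
    refine hA _ G ⟨⟨hU, isAcyclic_tree.induce _⟩, degree_induce_le U⟩ idG ?_ ?_
    · intro a b hab
      exact Subtype.ext (hinj a.2 b.2 hab)
    · intro x
      rw [hcard]
      have := hid x x.2
      rw [Finset.mem_Icc] at this ⊢
      exact ⟨this.1, this.2.trans (Nat.le_self_pow (Nat.one_le_iff_ne_zero.1 hC) _)⟩
  have hrun : ∀ (x : (U : Set (Word Δ))) (y : G.neighborSet x),
      A.run t Δ G idG x (Sum.inl y) =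
        A U.card (view U ident (t U.card) x) (Sum.inl (ident y)) := by
    intro x y
    unfold LocalAlgorithm.run
    rw [viewAt_induce hU ident, hcard]
    rfl
  let v' : (U : Set (Word Δ)) := ⟨v, hv⟩
  let w' : Fin Δ → (U : Set (Word Δ)) := fun α => ⟨step α v, hs α⟩
  have hadj : ∀ α, G.Adj v' (w' α) := fun α => adj_step α v
  constructor
  · have h1 := hsol.1 v'
    let E : Fin Δ → HalfEdgeAt Δ G v' := fun α => Sum.inl ⟨w' α, hadj α⟩
    have hEinj : Function.Injective E := by
      intro α β h
      have h2 : w' α = w' β := congrArg Subtype.val (Sum.inl.inj h)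
      exact step_left_injective v (congrArg Subtype.val h2)
    have hdeg : G.degree v' = Δ := by
      refine le_antisymm (degree_induce_le U v') ?_
      rw [← SimpleGraph.card_neighborSet_eq_degree]
      have := Fintype.card_le_of_injective (fun α => (⟨w' α, hadj α⟩ : G.neighborSet v'))
        (fun α β h => hEinj (congrArg Sum.inl h))
      rwa [Fintype.card_fin] at this
    have hEsurj : Function.Surjective E := by
      rintro (⟨y, α, hy⟩ | i)
      · exact ⟨α, congrArg Sum.inl (Subtype.ext (Subtype.ext hy.symm))⟩
      · exact absurd i.2 (by omega)
    have h3 : configAt (A.run t Δ G idG) v' = config A U.card (t U.card) U ident v := by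
      unfold configAt config
      rw [← Multiset.map_univ_val_equiv (Equiv.ofBijective E ⟨hEinj, hEsurj⟩), Multiset.map_map]
      refine Multiset.map_congr rfl fun α _ => ?_
      exact hrun v' ⟨w' α, hadj α⟩
    rwa [h3] at h1
  · intro α
    have h1 := hsol.2 v' (w' α) (hadj α)
    unfold edgeConfig at h1
    rw [hrun, hrun] at h1
    have h2 : output A U.card (t U.card) U ident (step α v) α =
        A U.card (view U ident (t U.card) (w' α)) (Sum.inl (ident v)) := by
      unfold output
      rw [step_step]
    rw [h2]
    exact h1

end Word

/-! ### Greedy extension of identifier assignments -/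

theorem exists_injOn_extend {X : Type*} [DecidableEq X] {A B : Finset X} (hAB : A ⊆ B) {n : ℕ}
    {f : X → ℕ} (hf : Set.InjOn f A) (hfn : ∀ x ∈ A, f x ∈ Finset.Icc 1 n) {F : Finset ℕ}
    (hn : B.card + F.card ≤ n) :
    ∃ g : X → ℕ, (∀ x ∈ A, g x = f x) ∧ Set.InjOn g B ∧ (∀ x ∈ B, g x ∈ Finset.Icc 1 n) ∧
      ∀ x ∈ B, x ∉ A → g x ∉ F := by
  have key : ∀ D : Finset X, Disjoint A D → (A ∪ D).card + F.card ≤ n →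
      ∃ g : X → ℕ, (∀ x ∈ A, g x = f x) ∧ Set.InjOn g ↑(A ∪ D) ∧
        (∀ x ∈ A ∪ D, g x ∈ Finset.Icc 1 n) ∧ ∀ x ∈ A ∪ D, x ∉ A → g x ∉ F := by
    intro D
    induction D using Finset.induction_on with
    | empty =>
      intro _ _
      exact ⟨f, fun _ _ => rfl, by simpa using hf, by simpa using hfn,
        fun x hx hxA => absurd (by simpa using hx) hxA⟩
    | insert a D ha ih =>
      intro hdis hcard
      rw [Finset.disjoint_insert_right] at hdis
      have haAD : a ∉ A ∪ D := by simp [hdis.1, ha]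
      rw [Finset.union_insert, Finset.card_insert_of_notMem haAD] at hcard
      obtain ⟨g, h1, h2, h3, h4⟩ := ih hdis.2 (by omega)
      obtain ⟨y, hy, hy'⟩ : ∃ y ∈ Finset.Icc 1 n, y ∉ (A ∪ D).image g ∪ F := by
        refine Finset.exists_mem_notMem_of_card_lt_card ?_
        refine (Finset.card_union_le _ _).trans_lt ?_
        have := Finset.card_image_le (s := A ∪ D) (f := g)
        simp only [Nat.card_Icc]
        omega
      rw [Finset.mem_union, not_or] at hy'
      have hne : ∀ x ∈ A ∪ D, Function.update g a y x = g x := by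
        intro x hx
        exact Function.update_of_ne (ne_of_mem_of_not_mem hx haAD) _ _
      refine ⟨Function.update g a y, ?_, ?_, ?_, ?_⟩
      · intro x hx
        rw [hne x (Finset.mem_union_left _ hx), h1 x hx]
      · rw [Finset.union_insert, Finset.coe_insert, Set.injOn_insert (by simpa using haAD)]
        refine ⟨h2.congr fun x hx => (hne x hx).symm, ?_⟩
        rintro ⟨x, hx, hxy⟩
        rw [hne x hx, Function.update_self] at hxy
        exact hy'.1 (Finset.mem_image.2 ⟨x, hx, hxy⟩)
      · intro x hx
        rw [Finset.union_insert, Finset.mem_insert] at hx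
        rcases hx with rfl | hx
        · rwa [Function.update_self]
        · rw [hne x hx]; exact h3 x hx
      · intro x hx hxA
        rw [Finset.union_insert, Finset.mem_insert] at hx
        rcases hx with rfl | hx
        · rw [Function.update_self]; exact hy'.2
        · rw [hne x hx]; exact h4 x hx hxA
  have := key (B \ A) Finset.disjoint_sdiff
  rw [Finset.union_sdiff_of_subset hAB] at this
  exact this hn

/-! ### Padding and cores -/

namespace Word

variable {Δ : ℕ} {Λ : Type*}

theorem exists_color_not_head (hΔ : 2 ≤ Δ) (x : Word Δ) : ∃ α, x.1.head? ≠ some α := by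
  by_contra! h
  have h1 := (h ⟨0, by omega⟩).symm.trans (h ⟨1, by omega⟩)
  simp at h1

/-- New leaves are hung below a vertex of maximal depth. Being deeper than all of `U` is what keeps
them out of the relevant views. -/
theorem exists_pad (hΔ : 2 ≤ Δ) {U : Finset (Word Δ)} (hU : IsConn U) {n : ℕ} (hn : U.card ≤ n) :
    ∃ U' : Finset (Word Δ), U ⊆ U' ∧ IsConn U' ∧ U'.card = n ∧
      ∀ x ∈ U', x ∉ U → ∀ y ∈ U, y.len < x.len := by
  induction n, hn using Nat.le_induction with
  | base => exact ⟨U, subset_rfl, hU, rfl, fun x hx hx' => absurd hx hx'⟩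
  | succ n hn ih =>
    obtain ⟨W, h1, h2, h3, h4⟩ := ih
    obtain ⟨⟨v, hv⟩⟩ := h2.nonempty
    obtain ⟨x, hx, hmax⟩ := Finset.exists_max_image W len ⟨v, hv⟩
    obtain ⟨α, hα⟩ := exists_color_not_head hΔ x
    have hlen := len_step_of_not_head hα
    have hnot : step α x ∉ W := fun h => by have := hmax _ h; omega
    refine ⟨insert (step α x) W, h1.trans (Finset.subset_insert _ _), ?_, ?_, ?_⟩
    · refine isConn_of_reach (v := x) (Finset.mem_insert_of_mem hx) fun y hy => ?_
      rw [Finset.mem_insert] at hy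
      rcases hy with rfl | hy
      · exact Relation.ReflTransGen.single ⟨adj_step α x, Finset.mem_insert_self _ _⟩
      · exact (h2.reach hx hy).mono (Finset.subset_insert _ _)
    · rw [Finset.card_insert_of_notMem hnot, h3]
    · intro y hy hyU z hz
      rw [Finset.mem_insert] at hy
      rcases hy with rfl | hy
      · have := hmax z (h1 hz); omega
      · exact h4 y hy hyU z hz

/-- The colour sequence `α, σ α, α, σ α, …`. -/
def alternate (σ : Fin Δ → Fin Δ) (α : Fin Δ) (j : ℕ) : Fin Δ := if Even j then α else σ α

theorem alternate_ne {σ : Fin Δ → Fin Δ} (hσ : ∀ α, σ α ≠ α) (α : Fin Δ) (j : ℕ) :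
    alternate σ α j ≠ alternate σ α (j + 1) := by
  unfold alternate
  by_cases h : Even j
  · have h' : ¬ Even (j + 1) := by simpa [Nat.even_add_one] using h
    simpa [h, h'] using (hσ α).symm
  · have h' : Even (j + 1) := by simpa [Nat.even_add_one] using h
    simpa [h, h'] using hσ α

/-- The `i`-th core around `v`: in all directions, long alternating paths of vertices that are
surrounded by the previous core. -/
def core (σ : Fin Δ → Fin Δ) (T : ℕ) : ℕ → Word Δ → Finset (Word Δ)
  | 0, v => {v}
  | i + 1, v => (Finset.univ : Finset (Fin Δ)).biUnion fun α =>
      (Finset.range (2 ^ i * T + 1)).biUnion fun j => core σ T i (walk (alternate σ α) v j)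

variable {σ : Fin Δ → Fin Δ} {T : ℕ}

theorem mem_core_succ {i : ℕ} {v x : Word Δ} : x ∈ core σ T (i + 1) v ↔
    ∃ α, ∃ j ≤ 2 ^ i * T, x ∈ core σ T i (walk (alternate σ α) v j) := by
  simp [core]

theorem core_walk_subset {i j : ℕ} (v : Word Δ) (α : Fin Δ) (hj : j ≤ 2 ^ i * T) :
    core σ T i (walk (alternate σ α) v j) ⊆ core σ T (i + 1) v :=
  fun _ hx => mem_core_succ.2 ⟨α, j, hj, hx⟩

theorem core_subset_succ (α : Fin Δ) (i : ℕ) (v : Word Δ) :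
    core σ T i v ⊆ core σ T (i + 1) v :=
  core_walk_subset (j := 0) v α (Nat.zero_le _)

theorem core_subset_core (α : Fin Δ) {i k : ℕ} (h : i ≤ k) (v : Word Δ) :
    core σ T i v ⊆ core σ T k v := by
  induction k, h using Nat.le_induction with
  | base => exact subset_rfl
  | succ k _ ih => exact ih.trans (core_subset_succ α k v)

theorem self_mem_core (α : Fin Δ) (i : ℕ) (v : Word Δ) : v ∈ core σ T i v :=
  core_subset_core α (Nat.zero_le i) v (by simp [core])

theorem walk_mem_core_succ {i j : ℕ} (v : Word Δ) (α : Fin Δ) (hj : j ≤ 2 ^ i * T) :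
    walk (alternate σ α) v j ∈ core σ T (i + 1) v :=
  core_walk_subset v α hj (self_mem_core α i _)

theorem step_mem_core (hT : 1 ≤ T) {i : ℕ} (hi : 1 ≤ i) (v : Word Δ) (α : Fin Δ) :
    step α v ∈ core σ T i v :=
  core_subset_core α hi v (walk_mem_core_succ (i := 0) (j := 1) v α (by simpa using hT))

/-- The `i`-th core has radius at most `(2 ^ i - 1) * T`, which is `T` less than the length of the
paths of the next core. A core centred further out than such a path therefore stays more than `T`
away from `v`. -/
theorem dist_of_mem_core {i : ℕ} {v x : Word Δ} (hx : x ∈ core σ T i v) :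
    (tree Δ).dist v x + T ≤ 2 ^ i * T := by
  induction i generalizing v with
  | zero =>
    obtain rfl : x = v := by simpa [core] using hx
    simp
  | succ i ih =>
    obtain ⟨α, j, hj, hx⟩ := mem_core_succ.1 hx
    have h1 := ih hx
    have h2 := dist_walk_le (alternate σ α) v j
    have h3 := connected_tree.dist_triangle (u := v) (v := walk (alternate σ α) v j) (w := x)
    rw [pow_succ]
    linarith

theorem card_core_le {i m : ℕ} (h : i ≤ m) (v : Word Δ) :
    (core σ T i v).card ≤ (Δ * (2 ^ m * T + 1)) ^ i := by
  induction i generalizing v with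
  | zero => simp [core]
  | succ i ih =>
    have h2 : ∀ α : Fin Δ, ((Finset.range (2 ^ i * T + 1)).biUnion fun j =>
        core σ T i (walk (alternate σ α) v j)).card ≤
          (2 ^ m * T + 1) * (Δ * (2 ^ m * T + 1)) ^ i := by
      intro α
      refine (Finset.card_biUnion_le_card_mul _ _ _ fun j _ => ih (by omega) _).trans ?_
      rw [Finset.card_range]
      gcongr
      · norm_num
      · omega
    refine (Finset.card_biUnion_le_card_mul _ _ _ fun α _ => h2 α).trans ?_
    rw [Finset.card_univ, Fintype.card_fin, pow_succ]
    exact le_of_eq (by ring)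

theorem reach_walk {U : Finset (Word Δ)} {e : ℕ → Fin Δ} {v : Word Δ} {j : ℕ}
    (h : ∀ i ≤ j, walk e v i ∈ U) : Reach U v (walk e v j) := by
  induction j with
  | zero => exact Relation.ReflTransGen.refl
  | succ j ih =>
    exact (ih fun i hi => h i (by omega)).tail ⟨adj_step _ _, h (j + 1) le_rfl⟩

theorem reach_core {i : ℕ} {v x : Word Δ} (hx : x ∈ core σ T i v) :
    Reach (core σ T i v) v x := by
  induction i generalizing v with
  | zero =>
    obtain rfl : x = v := by simpa [core] using hx
    exact Relation.ReflTransGen.refl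
  | succ i ih =>
    obtain ⟨α, j, hj, hx⟩ := mem_core_succ.1 hx
    exact (reach_walk fun k hk => walk_mem_core_succ v α (hk.trans hj)).trans
      ((ih hx).mono (core_walk_subset v α hj))

theorem isConn_core (α : Fin Δ) (i : ℕ) (v : Word Δ) : IsConn (core σ T i v) :=
  isConn_of_reach (self_mem_core α i v) fun _ hx => reach_core hx

theorem exists_mem_core_len (hΔ : 2 ≤ Δ) (hσ : ∀ α, σ α ≠ α) {i : ℕ} (hi : 1 ≤ i)
    (v : Word Δ) : ∃ y ∈ core σ T i v, y.len = v.len + T := by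
  obtain ⟨α, hα⟩ := exists_color_not_head hΔ v
  exact ⟨_, core_subset_core α hi v (walk_mem_core_succ (i := 0) (j := T) v α (by simp)),
    len_walk (q := T) hα (fun j _ => alternate_ne hσ α j) le_rfl⟩

/-- The tree is padded to exactly `n` vertices. Around `w`, the core contains a vertex `t n + 1`
levels deeper than `w`, and all padding is deeper still, hence too far from `w` to affect its
output. -/
theorem config_mem_of_core {P : LCL Δ Λ} {A : LocalAlgorithm Λ} {t : ℕ → ℕ} {C : ℕ}
    (hC : 1 ≤ C) (hA : A.Solves t C P) (hΔ : 2 ≤ Δ) (hσ : ∀ α, σ α ≠ α) {n : ℕ}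
    {U : Finset (Word Δ)} (hU : IsConn U) (hn : U.card ≤ n)
    {ident : Word Δ → ℕ} (hinj : Set.InjOn ident U) (hid : ∀ x ∈ U, ident x ∈ Finset.Icc 1 n)
    {i : ℕ} (hi : 1 ≤ i) {v : Word Δ} (hv : core σ (t n + 1) i v ⊆ U) :
    config A n (t n) U ident v ∈ P.vertexConfigs ∧
      ∀ α, core σ (t n + 1) i (step α v) ⊆ U →
        s(output A n (t n) U ident v α, output A n (t n) U ident (step α v) α) ∈
          P.edgeConfigs := by
  obtain ⟨U', hUU', hU', hcard, hlong⟩ := exists_pad hΔ hU hn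
  obtain ⟨g, hg1, hg2, hg3, -⟩ := exists_injOn_extend hUU' hinj hid (F := ∅) (by simp [hcard])
  let α₀ : Fin Δ := ⟨0, by omega⟩
  have hout : ∀ w, core σ (t n + 1) i w ⊆ U →
      output A n (t n) U' g w = output A n (t n) U ident w := by
    intro w hw
    refine output_congr_id A n (t n) (hw (self_mem_core α₀ i w))
      (fun α => hw (step_mem_core (by omega) hi w α)) hUU' (fun a ha _ => hg1 a ha) ?_
    intro a ha hd
    by_contra hna
    obtain ⟨y, hy, hylen⟩ := exists_mem_core_len (T := t n + 1) hΔ hσ hi w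
    have h1 := hlong a ha hna y (hw hy)
    have h2 := len_le_add_dist w a
    omega
  have key := config_mem_of_card_eq hC hA hU' hg2 (by rwa [hcard])
    (hUU' (hv (self_mem_core α₀ i v)))
    (fun α => hUU' (hv (step_mem_core (by omega) hi v α)))
  rw [hcard] at key
  constructor
  · have := key.1
    rwa [config, hout v hv] at this
  · intro α hα
    have := key.2 α
    rwa [hout v hv, hout _ hα] at this

end Word

/-! ### Linkable labels and full sets -/

section Linkable

variable {Δ : ℕ} {Λ : Type*}

/-- The labels `x` and `y` may stand on two different half-edges of a vertex with a configuration
from `S`. -/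
def Joint (S : Set (Multiset Λ)) (x y : Λ) : Prop := ∃ c ∈ S, x ::ₘ y ::ₘ 0 ≤ c

/-- Half-edges with labels `a` and `b` can be joined by a path with `m` inner vertices whose
configurations are in `S`. -/
def Linkable (P : LCL Δ Λ) (S : Set (Multiset Λ)) : ℕ → Λ → Λ → Prop
  | 0, a, b => s(a, b) ∈ P.edgeConfigs
  | m + 1, a, b => ∃ x y, s(a, x) ∈ P.edgeConfigs ∧ Joint S x y ∧ Linkable P S m y b

variable {P : LCL Δ Λ} {S : Set (Multiset Λ)}

theorem Linkable.trans {m m' : ℕ} {a x y b : Λ} (h : Linkable P S m a x) (hxy : Joint S x y)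
    (h' : Linkable P S m' y b) : Linkable P S (m + m' + 1) a b := by
  induction m generalizing a with
  | zero => rw [zero_add]; exact ⟨x, y, h, hxy, h'⟩
  | succ m ih =>
    obtain ⟨u, w, h1, h2, h3⟩ := h
    rw [show m + 1 + m' + 1 = (m + m' + 1) + 1 by ring]
    exact ⟨u, w, h1, h2, ih h3⟩

theorem linkable_of_seq {m : ℕ} {l r : ℕ → Λ}
    (hj : ∀ j, 1 ≤ j → j ≤ m → Joint S (l j) (r j))
    (he : ∀ j ≤ m, s(r j, l (j + 1)) ∈ P.edgeConfigs) : Linkable P S m (r 0) (l (m + 1)) := by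
  induction m generalizing l r with
  | zero => exact he 0 le_rfl
  | succ m ih =>
    refine ⟨l 1, r 1, he 0 (by omega), hj 1 le_rfl (by omega), ?_⟩
    exact ih (l := fun j => l (j + 1)) (r := fun j => r (j + 1))
      (fun j _ h2 => hj (j + 1) (by omega) (by omega)) (fun j h => he (j + 1) (by omega))

theorem Linkable.exists_seq {m : ℕ} {a b : Λ} (h : Linkable P S m a b) :
    ∃ l r : ℕ → Λ, r 0 = a ∧ l (m + 1) = b ∧ (∀ j, 1 ≤ j → j ≤ m → Joint S (l j) (r j)) ∧
      ∀ j ≤ m, s(r j, l (j + 1)) ∈ P.edgeConfigs := by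
  induction m generalizing a with
  | zero =>
    refine ⟨fun _ => b, fun _ => a, rfl, rfl, fun j h1 h2 => absurd h1 (by omega), fun j _ => h⟩
  | succ m ih =>
    obtain ⟨x, y, h1, h2, h3⟩ := h
    obtain ⟨l, r, hr, hl, hj, he⟩ := ih h3
    refine ⟨fun j => if j = 1 then x else l (j - 1), fun j => if j = 0 then a else r (j - 1),
      by simp, by simpa using hl, ?_, ?_⟩
    · rintro (_ | _ | j) h4 h5
      · omega
      · simpa [hr] using h2
      · simpa using hj (j + 1) (by omega) (by omega)
    · rintro (_ | j) h4
      · simpa using h1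
      · simpa using he j (by omega)

theorem exists_map_univ_fin_eq (s : Multiset Λ) {k : ℕ} (h : Multiset.card s = k) :
    ∃ g : Fin k → Λ, (Finset.univ : Finset (Fin k)).val.map g = s := by
  obtain ⟨l, rfl⟩ : ∃ l : List Λ, (l : Multiset Λ) = s := ⟨s.toList, s.coe_toList⟩
  rw [Multiset.coe_card] at h
  subst h
  exact ⟨l.get, by rw [Fin.univ_val_map, List.ofFn_get]⟩

/-- The two jointly available labels go on the path edges, and the other labels of `c` fill the
virtual half-edges. -/
theorem exists_labels_inner {m : ℕ} {v : Fin (m + 2)} (h0 : v ≠ 0) (h1 : v ≠ Fin.last (m + 1))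
    {c : Multiset Λ} (hc : Multiset.card c = Δ) {x y : Λ} (hxy : x ::ₘ y ::ₘ 0 ≤ c) :
    ∃ f : HalfEdgeAt Δ (SimpleGraph.pathGraph (m + 2)) v → Λ,
      (Finset.univ : Finset (HalfEdgeAt Δ (SimpleGraph.pathGraph (m + 2)) v)).val.map f = c ∧
      (∀ w, v < w.1 → f (Sum.inl w) = y) ∧ ∀ w, w.1 < v → f (Sum.inl w) = x := by
  have hv0 : 0 < v.1 := Nat.pos_of_ne_zero fun h => h0 (Fin.ext h)
  have hv1 : v.1 < m + 1 := by
    have : v.1 ≠ m + 1 := fun h => h1 (Fin.ext h)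
    have := v.2
    omega
  let p : (SimpleGraph.pathGraph (m + 2)).neighborSet v :=
    ⟨⟨v.1 - 1, by omega⟩, by
      rw [SimpleGraph.mem_neighborSet, SimpleGraph.pathGraph_adj]; right; simp; omega⟩
  let q : (SimpleGraph.pathGraph (m + 2)).neighborSet v :=
    ⟨⟨v.1 + 1, by omega⟩, by
      rw [SimpleGraph.mem_neighborSet, SimpleGraph.pathGraph_adj]; left; simp⟩
  have hpq : p ≠ q := by
    intro h
    have := congrArg (fun z => (z.1 : Fin (m + 2)).1) h
    simp only [p, q] at this
    omega
  have huniv : (Finset.univ : Finset ((SimpleGraph.pathGraph (m + 2)).neighborSet v)) =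
      {p, q} := by
    ext ⟨w, hw⟩
    simp only [Finset.mem_univ, Finset.mem_insert, Finset.mem_singleton, true_iff]
    rw [SimpleGraph.mem_neighborSet, SimpleGraph.pathGraph_adj] at hw
    rcases hw with hw | hw
    · right; exact Subtype.ext (Fin.ext hw.symm)
    · left; exact Subtype.ext (Fin.ext (by simp only [p]; omega))
  have hdeg : (SimpleGraph.pathGraph (m + 2)).degree v = 2 := by
    rw [← SimpleGraph.card_neighborSet_eq_degree, ← Finset.card_univ, huniv,
      Finset.card_pair hpq]
  obtain ⟨rest, rfl⟩ := Multiset.le_iff_exists_add.1 hxy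
  obtain ⟨g, hg⟩ := exists_map_univ_fin_eq rest
    (k := Δ - (SimpleGraph.pathGraph (m + 2)).degree v)
    (by rw [hdeg]; simp at hc; omega)
  refine ⟨Sum.elim (fun w => if w.1 < v then x else y) g, ?_, ?_, ?_⟩
  · rw [← Finset.univ_disjSum_univ, Finset.val_disjSum, Multiset.map_disjSum]
    simp only [Sum.elim_inl, Sum.elim_inr]
    rw [hg, huniv, Finset.insert_val_of_notMem (by simpa using hpq)]
    have hp : p.1 < v := Fin.lt_def.2 (by simp only [p]; omega)
    have hq : ¬ q.1 < v := fun h => by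
      have := Fin.lt_def.1 h
      simp only [q] at this
      omega
    simp [hp, hq]
  · intro w hw
    simp [not_lt.2 hw.le]
  · intro w hw
    simp [hw]

/-- Only the labels facing along the path are constrained by edges. At the ends any label of the
given configuration may face the path, so all pairs must be linkable. -/
theorem isFull_of_linkable (hS : S ⊆ P.vertexConfigs) {ℓ : ℕ}
    (h : ∀ m, ℓ ≤ m + 2 → ∀ c₁ ∈ S, ∀ c₂ ∈ S, ∀ a ∈ c₁, ∀ b ∈ c₂, Linkable P S m a b) :
    IsFull P S ℓ := by
  refine ⟨hS, fun m hm c₀ h0 h1 => ?_⟩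
  have hadj0 : (SimpleGraph.pathGraph (m + 2)).Adj 0 1 := by
    rw [SimpleGraph.pathGraph_adj]; left; simp
  have hadj1 : (SimpleGraph.pathGraph (m + 2)).Adj (Fin.last (m + 1)) ⟨m, by omega⟩ := by
    rw [SimpleGraph.pathGraph_adj]; right; simp
  obtain ⟨l, r, hr, hl, hj, he⟩ := (h m hm _ h0 _ h1 (c₀ 0 (Sum.inl ⟨1, hadj0⟩))
    (Multiset.mem_map_of_mem _ (Finset.mem_univ_val _))
    (c₀ (Fin.last (m + 1)) (Sum.inl ⟨⟨m, by omega⟩, hadj1⟩))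
    (Multiset.mem_map_of_mem _ (Finset.mem_univ_val _))).exists_seq
  have hex : ∀ v : Fin (m + 2), ∃ f : HalfEdgeAt Δ (SimpleGraph.pathGraph (m + 2)) v → Λ,
      (v = 0 → f = c₀ v) ∧ (v = Fin.last (m + 1) → f = c₀ v) ∧
      (Finset.univ : Finset (HalfEdgeAt Δ (SimpleGraph.pathGraph (m + 2)) v)).val.map f ∈ S ∧
      (∀ w, v < w.1 → f (Sum.inl w) = r v) ∧ ∀ w, w.1 < v → f (Sum.inl w) = l v := by
    intro v
    by_cases hv0 : v = 0
    · subst hv0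
      refine ⟨c₀ 0, fun _ => rfl, fun _ => rfl, h0, ?_, ?_⟩
      · rintro ⟨w, hw⟩ _
        obtain rfl : w = 1 := by
          rw [SimpleGraph.mem_neighborSet, SimpleGraph.pathGraph_adj] at hw
          refine Fin.ext ?_
          simp at hw ⊢
          omega
        exact hr.symm
      · intro w hw
        exact absurd hw (by simp)
    by_cases hv1 : v = Fin.last (m + 1)
    · subst hv1
      refine ⟨c₀ _, fun _ => rfl, fun _ => rfl, h1, ?_, ?_⟩
      · intro w hw
        exact absurd hw (not_lt.2 (Fin.le_last _))
      · rintro ⟨w, hw⟩ _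
        obtain rfl : w = ⟨m, by simp⟩ := by
          rw [SimpleGraph.mem_neighborSet, SimpleGraph.pathGraph_adj] at hw
          refine Fin.ext ?_
          have := w.2
          simp at hw ⊢
          omega
        exact hl.symm
    · have hpos : 1 ≤ v.1 := Nat.pos_of_ne_zero fun h => hv0 (Fin.ext h)
      have hlt : v.1 ≤ m := by
        have : v.1 ≠ m + 1 := fun h => hv1 (Fin.ext h)
        have := v.2
        omega
      obtain ⟨c, hcS, hc⟩ := hj v hpos hlt
      obtain ⟨f, hf, hf1, hf2⟩ := exists_labels_inner (Δ := Δ) hv0 hv1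
        (P.card_of_mem c (hS hcS)) hc
      exact ⟨f, fun h => absurd h hv0, fun h => absurd h hv1, by rwa [hf], hf1, hf2⟩
  choose c hc0 hc1 hcS hcr hcl using hex
  refine ⟨c, hc0 0 rfl, hc1 _ rfl, hcS, ?_⟩
  have key : ∀ (u v : Fin (m + 2)) (hadj : (SimpleGraph.pathGraph (m + 2)).Adj u v),
      u.1 + 1 = v.1 → edgeConfig c hadj ∈ P.edgeConfigs := by
    intro u v hadj huv
    unfold edgeConfig
    rw [hcr u ⟨v, hadj⟩ (Fin.lt_def.2 (by simp only; omega)),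
      hcl v ⟨u, hadj.symm⟩ (Fin.lt_def.2 (by simp only; omega)), ← huv]
    exact he u (by have := v.2; omega)
  intro u v hadj
  rcases SimpleGraph.pathGraph_adj.1 hadj with huv | huv
  · exact key u v hadj huv
  · have := key v u hadj.symm huv
    unfold edgeConfig at this ⊢
    rwa [Sym2.eq_swap]

theorem exists_joint (hΔ : 2 ≤ Δ) (hS : S ⊆ P.vertexConfigs) (hne : S.Nonempty) :
    ∃ c ∈ S, ∃ x ∈ c, ∃ y ∈ c, Joint S x y := by
  obtain ⟨c, hc⟩ := hne
  have hcard := P.card_of_mem c (hS hc)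
  obtain ⟨x, hx⟩ := Multiset.card_pos_iff_exists_mem.1 (by omega : 0 < Multiset.card c)
  obtain ⟨d, rfl⟩ := Multiset.exists_cons_of_mem hx
  rw [Multiset.card_cons] at hcard
  obtain ⟨y, hy⟩ := Multiset.card_pos_iff_exists_mem.1 (by omega : 0 < Multiset.card d)
  obtain ⟨e, rfl⟩ := Multiset.exists_cons_of_mem hy
  refine ⟨_, hc, x, by simp, y, by simp, _, hc, ?_⟩
  exact Multiset.cons_le_cons _ (Multiset.cons_le_cons _ (Multiset.zero_le _))

/-- A longer path is split at an inner vertex carrying any configuration of `S`: `ℓ - 2` inner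
vertices precede it and `m - ℓ + 1` follow, which is still enough for the induction. -/
theorem linkable_of_bounded (hΔ : 2 ≤ Δ) (hS : S ⊆ P.vertexConfigs) (hne : S.Nonempty) {ℓ : ℕ}
    (hℓ : 2 ≤ ℓ) (h : ∀ m, ℓ ≤ m + 2 → m + 2 ≤ 2 * ℓ →
      ∀ c₁ ∈ S, ∀ c₂ ∈ S, ∀ a ∈ c₁, ∀ b ∈ c₂, Linkable P S m a b) (m : ℕ) (hm : ℓ ≤ m + 2) :
    ∀ c₁ ∈ S, ∀ c₂ ∈ S, ∀ a ∈ c₁, ∀ b ∈ c₂, Linkable P S m a b := by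
  induction m using Nat.strong_induction_on with
  | _ m ih =>
    intro c₁ h1 c₂ h2 a ha b hb
    by_cases hm2 : m + 2 ≤ 2 * ℓ
    · exact h m hm hm2 c₁ h1 c₂ h2 a ha b hb
    obtain ⟨c, hc, x, hx, y, hy, hxy⟩ := exists_joint hΔ hS hne
    have l1 := h (ℓ - 2) (by omega) (by omega) c₁ h1 c hc a ha x hx
    have l2 := ih (m - ℓ + 1) (by omega) (by omega) c hc c₂ h2 y hy b hb
    have := l1.trans hxy l2
    rwa [show ℓ - 2 + (m - ℓ + 1) + 1 = m by omega] at this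

end Linkable

/-! ### Identifiers, colours and realizations for gluing -/

theorem exists_ident_pair {X : Type*} [DecidableEq X] {U B₁ B₂ : Finset X} (h₁ : B₁ ⊆ U)
    (h₂ : B₂ ⊆ U) {n : ℕ} {f₁ f₂ : X → ℕ} (hf₁ : Set.InjOn f₁ B₁) (hf₂ : Set.InjOn f₂ B₂)
    (hr₁ : ∀ x ∈ B₁, f₁ x ∈ Finset.Icc 1 n)
    (hr₂ : ∀ x ∈ B₂, f₂ x ∈ Finset.Icc 1 n) (hn : U.card + (B₁.card + B₂.card) ≤ n) :
    ∃ j₁ j₂ : X → ℕ, Set.InjOn j₁ U ∧ Set.InjOn j₂ U ∧ (∀ x ∈ U, j₁ x ∈ Finset.Icc 1 n) ∧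
      (∀ x ∈ U, j₂ x ∈ Finset.Icc 1 n) ∧ (∀ x ∈ B₁, j₁ x = f₁ x) ∧ (∀ x ∈ B₂, j₂ x = f₂ x) ∧
      ∀ x ∈ U, x ∉ B₁ → x ∉ B₂ → j₁ x = j₂ x := by
  -- The common values on `R` avoid the images of both `f₁` and `f₂`, so they are compatible with
  -- either assignment.
  let R := U \ (B₁ ∪ B₂)
  have hR : R ⊆ U := Finset.sdiff_subset
  have hRB : ∀ x ∈ R, x ∉ B₁ ∧ x ∉ B₂ := by
    intro x hx
    have := (Finset.mem_sdiff.1 hx).2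
    simpa using this
  obtain ⟨g, -, hg1, hg2, hg3⟩ := exists_injOn_extend (A := ∅) (B := R) (n := n) (f := f₁)
    (F := B₁.image f₁ ∪ B₂.image f₂) (Finset.empty_subset _) (by simp) (by simp) (by
      have h1 := Finset.card_le_card hR
      have h2 := Finset.card_union_le (B₁.image f₁) (B₂.image f₂)
      have h3 := Finset.card_image_le (s := B₁) (f := f₁)
      have h4 := Finset.card_image_le (s := B₂) (f := f₂)
      omega)
  have key : ∀ (B : Finset X) (f : X → ℕ), B ⊆ U → Set.InjOn f B →
      (∀ x ∈ B, f x ∈ Finset.Icc 1 n) → (∀ x ∈ R, x ∉ B) → (∀ x ∈ R, g x ∉ B.image f) →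
      ∃ j : X → ℕ, Set.InjOn j U ∧ (∀ x ∈ U, j x ∈ Finset.Icc 1 n) ∧ (∀ x ∈ B, j x = f x) ∧
        ∀ x ∈ R, j x = g x := by
    intro B f hBU hf hr hRB hgB
    obtain ⟨j, hj1, hj2, hj3, -⟩ := exists_injOn_extend (A := B ∪ R) (B := U) (n := n)
      (f := fun x => if x ∈ B then f x else g x) (F := ∅) (Finset.union_subset hBU hR)
      (by
        have hne : ∀ x ∈ B, ∀ y ∈ R, f x ≠ g y := fun x hx y hy h =>
          hgB y hy (Finset.mem_image.2 ⟨x, hx, h⟩)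
        intro x hx y hy hxy
        simp only [Finset.coe_union, Set.mem_union, Finset.mem_coe] at hx hy
        rcases hx with hx | hx <;> rcases hy with hy | hy
        · simp only [hx, hy, if_true] at hxy
          exact hf hx hy hxy
        · simp only [hx, hRB y hy, if_true, if_false] at hxy
          exact absurd hxy (hne x hx y hy)
        · simp only [hRB x hx, hy, if_true, if_false] at hxy
          exact absurd hxy.symm (hne y hy x hx)
        · simp only [hRB x hx, hRB y hy, if_false] at hxy
          exact hg1 hx hy hxy)
      (by
        intro x hx
        rcases Finset.mem_union.1 hx with hx | hx
        · simp only [hx, if_true]; exact hr x hx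
        · simp only [hRB x hx, if_false]; exact hg2 x hx)
      (by simp; omega)
    refine ⟨j, hj2, hj3, fun x hx => ?_, fun x hx => ?_⟩
    · rw [hj1 x (Finset.mem_union_left _ hx)]; simp [hx]
    · rw [hj1 x (Finset.mem_union_right _ hx)]; simp [hRB x hx]
  have hg4 : ∀ x ∈ R, g x ∉ B₁.image f₁ ∧ g x ∉ B₂.image f₂ := by
    intro x hx
    have := hg3 x hx (Finset.notMem_empty x)
    rwa [Finset.mem_union, not_or] at this
  obtain ⟨j₁, a1, a2, a3, a4⟩ := key B₁ f₁ h₁ hf₁ hr₁ (fun x hx => (hRB x hx).1)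
    fun x hx => (hg4 x hx).1
  obtain ⟨j₂, b1, b2, b3, b4⟩ := key B₂ f₂ h₂ hf₂ hr₂ (fun x hx => (hRB x hx).2)
    fun x hx => (hg4 x hx).2
  refine ⟨j₁, j₂, a1, b1, a2, b2, a3, b3, fun x hx hx1 hx2 => ?_⟩
  have hxR : x ∈ R := Finset.mem_sdiff.2 ⟨hx, by simp [hx1, hx2]⟩
  rw [a4 x hxR, b4 x hxR]

theorem cons_cons_le_map_univ {ι Λ : Type*} [Fintype ι] (f : ι → Λ) {a b : ι} (h : a ≠ b) :
    f a ::ₘ f b ::ₘ 0 ≤ (Finset.univ : Finset ι).val.map f := by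
  classical
  have h1 : ({a, b} : Finset ι).val ≤ (Finset.univ : Finset ι).val :=
    Finset.val_le_iff.2 (Finset.subset_univ _)
  have h2 := Multiset.map_le_map (f := f) h1
  rwa [Finset.insert_val_of_notMem (by simpa using h), Finset.singleton_val, Multiset.map_cons,
    Multiset.map_singleton] at h2

namespace Word

variable {Δ : ℕ} {Λ : Type*}

/-- A single filler colour may have to avoid both `a` and `b`; this needs three colours. -/
theorem exists_filler (hΔ : 3 ≤ Δ) (a b : Fin Δ) (p : ℕ) :
    ∃ g : ℕ → Fin Δ, g 0 ≠ a ∧ g p ≠ b ∧ ∀ j < p, g j ≠ g (j + 1) := by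
  have hpick : ∀ a b : Fin Δ, ∃ c, c ≠ a ∧ c ≠ b := by
    intro a b
    obtain ⟨c, -, hc⟩ : ∃ c ∈ (Finset.univ : Finset (Fin Δ)), c ∉ ({a, b} : Finset (Fin Δ)) := by
      refine Finset.exists_mem_notMem_of_card_lt_card ?_
      have := Finset.card_le_two (a := a) (b := b)
      simp only [Finset.card_univ, Fintype.card_fin]
      omega
    simp only [Finset.mem_insert, Finset.mem_singleton, not_or] at hc
    exact ⟨c, hc⟩
  induction p generalizing a with
  | zero =>
    obtain ⟨c, h1, h2⟩ := hpick a b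
    exact ⟨fun _ => c, h1, h2, fun j hj => absurd hj (by omega)⟩
  | succ p ih =>
    obtain ⟨c, h1, -⟩ := hpick a a
    obtain ⟨g, g1, g2, g3⟩ := ih c
    refine ⟨fun j => Nat.casesOn j c g, h1, g2, ?_⟩
    rintro (_ | j) hj
    · exact g1.symm
    · exact g3 j (by omega)

theorem exists_colors (hΔ : 3 ≤ Δ) {e f : ℕ → Fin Δ} {L q : ℕ} (hL : 1 ≤ L) (hq : 2 * L + 1 ≤ q)
    (he : ∀ j, e j ≠ e (j + 1)) (hf : ∀ j, f j ≠ f (j + 1)) :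
    ∃ d : ℕ → Fin Δ, (∀ j < L, d j = e j) ∧ (∀ j < L, d (q - 1 - j) = f j) ∧
      ∀ j, j + 1 < q → d j ≠ d (j + 1) := by
  obtain ⟨g, g1, g2, g3⟩ := exists_filler hΔ (e (L - 1)) (f (L - 1)) (q - 2 * L - 1)
  refine ⟨fun j => if j < L then e j else if j < q - L then g (j - L) else f (q - 1 - j),
    ?_, ?_, ?_⟩
  · intro j hj
    simp [hj]
  · intro j hj
    have h1 : ¬ q - 1 - j < L := by omega
    have h2 : ¬ q - 1 - j < q - L := by omega
    simp only [h1, h2, if_false]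
    congr 1
    omega
  · intro j hj
    simp only
    by_cases c1 : j + 1 < L
    · rw [if_pos (by omega : j < L), if_pos c1]
      exact he j
    by_cases c2 : j < L
    · rw [if_pos c2, if_neg c1, if_pos (by omega : j + 1 < q - L)]
      rw [show j + 1 - L = 0 by omega, show j = L - 1 by omega]
      exact g1.symm
    by_cases c3 : j + 1 < q - L
    · rw [if_neg c2, if_neg c1, if_pos (by omega : j < q - L), if_pos c3]
      rw [show j + 1 - L = j - L + 1 by omega]
      exact g3 _ (by omega)
    by_cases c4 : j < q - L
    · rw [if_neg c2, if_neg c1, if_pos c4, if_neg c3]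
      rw [show j - L = q - 2 * L - 1 by omega, show q - 1 - (j + 1) = L - 1 by omega]
      exact g2
    · rw [if_neg c2, if_neg c1, if_neg c4, if_neg c3]
      rw [show q - 1 - j = q - 1 - (j + 1) + 1 by omega]
      exact (hf _).symm

theorem IsColorMap.map_core {f : Word Δ → Word Δ} (hf : IsColorMap f) {σ : Fin Δ → Fin Δ}
    {T i : ℕ} {v : Word Δ} : core σ T i (f v) = (core σ T i v).image f := by
  induction i generalizing v with
  | zero => simp [core]
  | succ i ih =>
    ext x
    simp only [mem_core_succ, Finset.mem_image, ← hf.walk, ih]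
    constructor
    · rintro ⟨α, j, hj, y, hy, rfl⟩
      exact ⟨y, ⟨α, j, hj, hy⟩, rfl⟩
    · rintro ⟨y, ⟨α, j, hj, hy⟩, rfl⟩
      exact ⟨α, j, hj, y, hy, rfl⟩

theorem IsColorMap.isConn_image {f : Word Δ → Word Δ} (hf : IsColorMap f) {U : Finset (Word Δ)}
    (hU : IsConn U) : IsConn (U.image f) := by
  obtain ⟨⟨v, hv⟩⟩ := hU.nonempty
  refine isConn_of_reach (Finset.mem_image_of_mem f hv) ?_
  intro y hy
  obtain ⟨x, hx, rfl⟩ := Finset.mem_image.1 hy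
  refine Relation.ReflTransGen.lift f ?_ _ _ (hU.reach hv hx)
  rintro a b ⟨⟨α, rfl⟩, hb⟩
  exact ⟨⟨α, hf α a⟩, Finset.mem_image_of_mem f hb⟩

/-- The configurations that the algorithm `A`, run with radius `t` and the parameter `n`, returns
at vertices surrounded by the `i`-th core, in trees with at most `N` vertices. -/
def coreConfigs (A : LocalAlgorithm Λ) (n t : ℕ) (σ : Fin Δ → Fin Δ) (i N : ℕ) :
    Set (Multiset Λ) :=
  {c | ∃ (U : Finset (Word Δ)) (ident : Word Δ → ℕ) (v : Word Δ), IsConn U ∧ U.card ≤ N ∧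
    Set.InjOn ident U ∧ (∀ x ∈ U, ident x ∈ Finset.Icc 1 n) ∧ core σ (t + 1) i v ⊆ U ∧
    config A n t U ident v = c}

/-- The colour `β` is chosen before the vertex `y`, since the path, and with it its far endpoint,
depends on `β`. -/
theorem exists_realization {A : LocalAlgorithm Λ} {n t : ℕ} {σ : Fin Δ → Fin Δ} {i N : ℕ}
    (hi : 1 ≤ i) {c : Multiset Λ} (hc : c ∈ coreConfigs A n t σ i N) {b : Λ} (hb : b ∈ c) :
    ∃ β : Fin Δ, ∀ y : Word Δ, ∃ (U : Finset (Word Δ)) (ident : Word Δ → ℕ), IsConn U ∧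
      U.card ≤ N ∧ Set.InjOn ident U ∧ (∀ x ∈ U, ident x ∈ Finset.Icc 1 n) ∧
      core σ (t + 1) i y ⊆ U ∧ output A n t U ident y β = b := by
  obtain ⟨U, ident, v, hU, hcard, hinj, hid, hcore, rfl⟩ := hc
  obtain ⟨β, -, hβ⟩ := Multiset.mem_map.1 hb
  refine ⟨β, fun y => ?_⟩
  obtain ⟨f, g, hf, hg, rfl, hgf⟩ := exists_colorMap v y
  refine ⟨U.image f, ident ∘ g, hf.isConn_image hU, Finset.card_image_le.trans hcard, ?_, ?_, ?_,
    ?_⟩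
  · intro a ha b hb hab
    obtain ⟨a, ha', rfl⟩ := Finset.mem_image.1 (Finset.mem_coe.1 ha)
    obtain ⟨b, hb', rfl⟩ := Finset.mem_image.1 (Finset.mem_coe.1 hb)
    simp only [Function.comp_apply, hgf a, hgf b] at hab
    rw [hinj ha' hb' hab]
  · intro a ha
    obtain ⟨a, ha', rfl⟩ := Finset.mem_image.1 ha
    simp only [Function.comp_apply, hgf a]
    exact hid a ha'
  · rw [hf.map_core]
    exact Finset.image_subset_image hcore
  · rw [← hβ]
    refine congrFun (output_congr A n t hf hg hgf (hcore (self_mem_core β i v))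
      (fun α => hcore (step_mem_core (by omega) hi v α)) ?_ ?_) β
    · intro a ha _
      exact ⟨Finset.mem_image_of_mem f ha, by simp [hgf a]⟩
    · intro a ha _
      obtain ⟨a, ha', rfl⟩ := Finset.mem_image.1 ha
      exact ⟨a, ha', rfl⟩

end Word

/-! ### Linking two configurations by a long path -/

namespace Word

variable {Δ : ℕ} {Λ : Type*}

theorem linkable_coreConfigs {P : LCL Δ Λ} {A : LocalAlgorithm Λ} {t : ℕ → ℕ} {C : ℕ}
    (hC : 1 ≤ C) (hA : A.Solves t C P) (hΔ : 3 ≤ Δ) {σ : Fin Δ → Fin Δ} (hσ : ∀ α, σ α ≠ α)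
    {n i N N' K m : ℕ} (hi : 1 ≤ i) (hK : ∀ v, (core σ (t n + 1) i v).card ≤ K)
    (hm : N + 2 * (2 ^ i * (t n + 1)) + 4 * (t n + 1) + 2 ≤ m)
    (hN' : 2 * N + (m + 2) * K ≤ N') (hn : N' + 2 * N ≤ n) {c₁ c₂ : Multiset Λ}
    (hc₁ : c₁ ∈ coreConfigs A n (t n) σ (i + 1) N)
    (hc₂ : c₂ ∈ coreConfigs A n (t n) σ (i + 1) N) {a b : Λ} (ha : a ∈ c₁) (hb : b ∈ c₂) :
    Linkable P (coreConfigs A n (t n) σ i N') m a b := by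
  obtain ⟨α, hα⟩ := exists_realization (by omega) hc₁ ha
  obtain ⟨β, hβ⟩ := exists_realization (by omega) hc₂ hb
  set T := t n + 1 with hT
  set L := 2 ^ i * T with hL
  have hTL : T ≤ L := Nat.le_mul_of_pos_left _ (by positivity)
  obtain ⟨d, hd1, hd2, hd3⟩ := exists_colors (q := m + 1) (L := L) hΔ (by omega) (by omega)
    (alternate_ne hσ α) (alternate_ne hσ β)
  set z : ℕ → Word Δ := walk d nil with hz
  have hlen : ∀ j ≤ m + 1, (z j).len = j := by
    intro j hj
    have h0 : (nil : Word Δ).len = 0 := rfl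
    have := len_walk (x := nil) (e := d) (q := m + 1) (by simp [nil]) hd3 hj
    rwa [h0, zero_add] at this
  obtain ⟨U₁, id₁, hU₁, hcard₁, hinj₁, hid₁, hcore₁, hout₁⟩ := hα nil
  obtain ⟨U₂, id₂, hU₂, hcard₂, hinj₂, hid₂, hcore₂, hout₂⟩ := hβ (z (m + 1))
  have hnil₁ : nil ∈ U₁ := hcore₁ (self_mem_core α _ _)
  have hend₂ : z (m + 1) ∈ U₂ := hcore₂ (self_mem_core α _ _)
  have hstart : ∀ j ≤ L, core σ T i (z j) ⊆ U₁ := by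
    intro j hj
    have h1 : z j = walk (alternate σ α) nil j := walk_congr nil fun k hk => hd1 k (by omega)
    rw [h1]
    exact (core_walk_subset nil α hj).trans hcore₁
  have hend : ∀ j ≤ L, core σ T i (z (m + 1 - j)) ⊆ U₂ := by
    intro j hj
    have h1 : walk (alternate σ β) (z (m + 1)) j = z (m + 1 - j) :=
      walk_reverse (by omega) fun k hk => (hd2 k (by omega)).symm
    rw [← h1]
    exact (core_walk_subset _ β hj).trans hcore₂
  -- Positions within `L` of an end already have their cores in `U₁` or `U₂`. The cores added for
  -- the others have radius at most `L - T`, so they stay more than `T` away from both ends.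
  let J := (Finset.range (m + 2)).filter fun j => L < j ∧ j + L < m + 1
  let W := J.biUnion fun j => core σ T i (z j)
  let U := U₁ ∪ U₂ ∪ W
  have hU₁U : U₁ ⊆ U := fun x hx => by simp [U, hx]
  have hU₂U : U₂ ⊆ U := fun x hx => by simp [U, hx]
  have hWU : W ⊆ U := Finset.subset_union_right
  have hzU : ∀ j ≤ m + 1, core σ T i (z j) ⊆ U := by
    intro j hj
    by_cases h1 : j ≤ L
    · exact (hstart j h1).trans hU₁U
    by_cases h2 : j + L < m + 1
    · refine Finset.Subset.trans ?_ hWU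
      have hjJ : j ∈ J := by simp only [J, Finset.mem_filter, Finset.mem_range]; omega
      exact Finset.subset_biUnion_of_mem (fun j => core σ T i (z j)) hjJ
    · have := hend (m + 1 - j) (by omega)
      rw [show m + 1 - (m + 1 - j) = j by omega] at this
      exact this.trans hU₂U
  have hzmem : ∀ j ≤ m + 1, z j ∈ U := fun j hj => hzU j hj (self_mem_core α i _)
  have hmemU : ∀ x ∈ U, x ∈ U₁ ∨ x ∈ U₂ ∨
      ∃ j, L < j ∧ j + L < m + 1 ∧ x ∈ core σ T i (z j) := by
    intro x hx
    simp only [U, W, J, Finset.mem_union, Finset.mem_biUnion, Finset.mem_filter] at hx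
    rcases hx with (hx | hx) | ⟨j, ⟨-, h1, h2⟩, hx⟩
    · exact Or.inl hx
    · exact Or.inr (Or.inl hx)
    · exact Or.inr (Or.inr ⟨j, h1, h2, hx⟩)
  have hreach : ∀ j ≤ m + 1, Reach U nil (z j) := fun j hj =>
    reach_walk fun k hk => hzmem k (hk.trans hj)
  have hU : IsConn U := by
    refine isConn_of_reach (v := nil) (hU₁U hnil₁) fun x hx => ?_
    rcases hmemU x hx with hx | hx | ⟨j, h1, h2, hx⟩
    · exact (hU₁.reach hnil₁ hx).mono hU₁U
    · exact (hreach (m + 1) le_rfl).trans ((hU₂.reach hend₂ hx).mono hU₂U)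
    · exact (hreach j (by omega)).trans ((reach_core hx).mono (hzU j (by omega)))
  have hcardU : U.card ≤ N' := by
    have h1 : W.card ≤ (m + 2) * K := by
      refine (Finset.card_biUnion_le_card_mul _ _ K fun j _ => hK (z j)).trans ?_
      refine Nat.mul_le_mul_right K ?_
      exact (Finset.card_filter_le _ _).trans (Finset.card_range _).le
    have h2 := Finset.card_union_le (U₁ ∪ U₂) W
    have h3 := Finset.card_union_le U₁ U₂
    simp only [U]
    omega
  -- Here `U₂` is far away because its diameter is at most `N`, while the path is longer than `N +
  -- T`.
  have hnear₁ : ∀ x ∈ U, (tree Δ).dist nil x ≤ T → x ∈ U₁ := by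
    intro x hx hd
    have hxlen := len_le_add_dist nil x
    have h0 : (nil : Word Δ).len = 0 := rfl
    rcases hmemU x hx with hx | hx | ⟨j, h1, h2, hx⟩
    · exact hx
    · have h3 := hU₂.dist_le_card hx hend₂
      have h4 := len_le_add_dist x (z (m + 1))
      rw [hlen _ le_rfl] at h4
      omega
    · have h3 := dist_of_mem_core hx
      have h4 := len_le_add_dist x (z j)
      rw [hlen _ (by omega), SimpleGraph.dist_comm] at h4
      omega
  have hnear₂ : ∀ x ∈ U, (tree Δ).dist (z (m + 1)) x ≤ T → x ∈ U₂ := by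
    intro x hx hd
    have hxlen := len_le_add_dist x (z (m + 1))
    rw [hlen _ le_rfl, SimpleGraph.dist_comm] at hxlen
    have h0 : (nil : Word Δ).len = 0 := rfl
    rcases hmemU x hx with hx | hx | ⟨j, h1, h2, hx⟩
    · have h3 := hU₁.dist_le_card hnil₁ hx
      have h4 := len_le_add_dist nil x
      omega
    · exact hx
    · have h3 := dist_of_mem_core hx
      have h4 := len_le_add_dist (z j) x
      rw [hlen _ (by omega)] at h4
      omega
  let B₁ := U₁.filter fun x => (tree Δ).dist nil x ≤ T
  let B₂ := U₂.filter fun x => (tree Δ).dist (z (m + 1)) x ≤ T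
  have hB₁ : B₁ ⊆ U₁ := Finset.filter_subset _ _
  have hB₂ : B₂ ⊆ U₂ := Finset.filter_subset _ _
  obtain ⟨j₁, j₂, hj₁, hj₂, hr₁, hr₂, he₁, he₂, heq⟩ := exists_ident_pair (n := n)
    (hB₁.trans hU₁U) (hB₂.trans hU₂U) (hinj₁.mono hB₁) (hinj₂.mono hB₂)
    (fun x hx => hid₁ x (hB₁ hx)) (fun x hx => hid₂ x (hB₂ hx)) (by
      have h1 := Finset.card_le_card hB₁
      have h2 := Finset.card_le_card hB₂
      omega)
  have hstepU : ∀ j ≤ m + 1, ∀ γ, step γ (z j) ∈ U := fun j hj γ =>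
    hzU j hj (step_mem_core (by omega) hi _ γ)
  have hO₁ : output A n (t n) U j₁ nil = output A n (t n) U₁ id₁ nil :=
    output_congr_id A n (t n) hnil₁ (fun γ => hcore₁ (step_mem_core (by omega) (by omega) _ γ))
      hU₁U (fun x hx hd => he₁ x (Finset.mem_filter.2 ⟨hx, hd⟩)) hnear₁
  have hO₂ : output A n (t n) U j₂ (z (m + 1)) = output A n (t n) U₂ id₂ (z (m + 1)) :=
    output_congr_id A n (t n) hend₂ (fun γ => hcore₂ (step_mem_core (by omega) (by omega) _ γ))
      hU₂U (fun x hx hd => he₂ x (Finset.mem_filter.2 ⟨hx, hd⟩)) hnear₂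
  -- The `T`-ball around position `2 * T + 1` misses the `T`-balls around both ends, and `j₁` and
  -- `j₂` agree outside those.
  have hO₃ : output A n (t n) U j₁ (z (2 * T + 1)) = output A n (t n) U j₂ (z (2 * T + 1)) := by
    refine output_congr_id A n (t n) (hzmem _ (by omega)) (hstepU _ (by omega)) subset_rfl ?_
      (fun x hx _ => hx)
    intro x hx hd
    have h1 := len_le_add_dist (z (2 * T + 1)) x
    have h2 := len_le_add_dist x (z (2 * T + 1))
    rw [SimpleGraph.dist_comm] at h2
    rw [hlen _ (by omega)] at h1 h2
    refine heq x hx (fun hxB => ?_) fun hxB => ?_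
    · have h3 := (Finset.mem_filter.1 hxB).2
      have h4 := len_le_add_dist nil x
      have h0 : (nil : Word Δ).len = 0 := rfl
      omega
    · have h3 := (Finset.mem_filter.1 hxB).2
      have h4 := len_le_add_dist x (z (m + 1))
      rw [hlen _ le_rfl, SimpleGraph.dist_comm] at h4
      omega
  let ids : ℕ → Word Δ → ℕ := fun j => if j < 2 * T + 1 then j₁ else j₂
  let o : ℕ → Fin Δ → Λ := fun j => output A n (t n) U (ids j) (z j)
  have hids : ∀ j, ids j = j₁ ∨ ids j = j₂ := by
    intro j
    by_cases h : j < 2 * T + 1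
    · exact Or.inl (if_pos h)
    · exact Or.inr (if_neg h)
  have hidsinj : ∀ j, Set.InjOn (ids j) U := by
    intro j
    rcases hids j with h | h <;> rwa [h]
  have hidsr : ∀ j, ∀ x ∈ U, ids j x ∈ Finset.Icc 1 n := by
    intro j
    rcases hids j with h | h <;> rwa [h]
  -- Only the edge from position `2 * T` to `2 * T + 1` crosses the switch, and at its far end both
  -- assignments give the same output.
  have ho : ∀ j, output A n (t n) U (ids j) (z (j + 1)) = o (j + 1) := by
    intro j
    rcases lt_trichotomy j (2 * T) with h | h | h
    · simp only [o, ids]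
      rw [if_pos (by omega), if_pos (by omega)]
    · subst h
      simp only [o, ids]
      rw [if_pos (by omega), if_neg (by omega), hO₃]
    · simp only [o, ids]
      rw [if_neg (by omega), if_neg (by omega)]
  have hr0 : o 0 (d 0) = a := by
    have h1 : d 0 = α := hd1 0 (by omega)
    have h2 : ids 0 = j₁ := if_pos (by omega)
    simp only [o]
    rw [h1, h2]
    exact (congrFun hO₁ α).trans hout₁
  have hl1 : o (m + 1) (d m) = b := by
    have h1 : d m = β := hd2 0 (by omega)
    have h2 : ids (m + 1) = j₂ := if_neg (by omega)
    simp only [o]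
    rw [h1, h2, hO₂, hout₂]
  have key := linkable_of_seq (P := P) (S := coreConfigs A n (t n) σ i N') (m := m)
    (l := fun j => o j (d (j - 1))) (r := fun j => o j (d j))
    (by
      intro j h1 h2
      refine ⟨config A n (t n) U (ids j) (z j), ⟨U, ids j, z j, hU, hcardU, hidsinj j, hidsr j,
        hzU j (by omega), rfl⟩, cons_cons_le_map_univ _ ?_⟩
      have := hd3 (j - 1) (by omega)
      rwa [show j - 1 + 1 = j by omega] at this)
    (by
      intro j hj
      have h1 := (config_mem_of_core hC hA (by omega) hσ hU (by omega) (hidsinj j) (hidsr j) hi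
        (hzU j (by omega))).2 (d j) (hzU (j + 1) (by omega))
      change s(o j (d j), output A n (t n) U (ids j) (z (j + 1)) (d j)) ∈ _ at h1
      rwa [ho j] at h1)
  simpa only [hr0, hl1, Nat.add_sub_cancel] using key

end Word

/-! ### Growth estimates and stabilization -/

/-- Functions bounded by a power of `T + 2`. -/
def PolyBounded (f : ℕ → ℕ) : Prop := ∃ d : ℕ, ∀ T, f T ≤ (T + 2) ^ d

namespace PolyBounded

theorem const (c : ℕ) : PolyBounded fun _ => c :=
  ⟨c, fun T => (Nat.lt_pow_self (by omega)).le⟩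

theorem id : PolyBounded fun T => T := ⟨1, fun T => by simp⟩

theorem mul {f g : ℕ → ℕ} (hf : PolyBounded f) (hg : PolyBounded g) :
    PolyBounded fun T => f T * g T := by
  obtain ⟨a, ha⟩ := hf
  obtain ⟨b, hb⟩ := hg
  exact ⟨a + b, fun T => by rw [pow_add]; exact Nat.mul_le_mul (ha T) (hb T)⟩

theorem add {f g : ℕ → ℕ} (hf : PolyBounded f) (hg : PolyBounded g) :
    PolyBounded fun T => f T + g T := by
  obtain ⟨a, ha⟩ := hf
  obtain ⟨b, hb⟩ := hg
  refine ⟨a + b + 1, fun T => ?_⟩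
  have h1 : (T + 2) ^ a ≤ (T + 2) ^ (a + b) := Nat.pow_le_pow_right (by omega) (by omega)
  have h2 : (T + 2) ^ b ≤ (T + 2) ^ (a + b) := Nat.pow_le_pow_right (by omega) (by omega)
  calc f T + g T ≤ (T + 2) ^ (a + b) * 2 := by have := ha T; have := hb T; omega
    _ ≤ (T + 2) ^ (a + b) * (T + 2) := Nat.mul_le_mul_left _ (by omega)
    _ = (T + 2) ^ (a + b + 1) := (pow_succ _ _).symm

theorem pow {f : ℕ → ℕ} (hf : PolyBounded f) (k : ℕ) : PolyBounded fun T => f T ^ k := by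
  obtain ⟨a, ha⟩ := hf
  exact ⟨a * k, fun T => by rw [pow_mul]; exact Nat.pow_le_pow_left (ha T) k⟩

end PolyBounded

/-- For `n = k ^ (2 * (d + 1))` with `k` large, `t n ≤ k`, and `k ≥ 3` gives `k + 3 ≤ k ^ 2`; hence
the polynomial bound is at most `k ^ (2 * d)`. -/
theorem IsSubpolynomial.exists_le {t : ℕ → ℕ} (ht : IsSubpolynomial t) {f : ℕ → ℕ}
    (hf : PolyBounded f) : ∃ n, f (t n + 1) ≤ n := by
  obtain ⟨d, hd⟩ := hf
  have hε : (0 : ℝ) < ((2 * (d + 1) : ℕ) : ℝ)⁻¹ := by positivity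
  obtain ⟨n₀, hn₀⟩ := Filter.eventually_atTop.1 (ht _ hε)
  let k := max n₀ 3
  have hk3 : 3 ≤ k := le_max_right _ _
  refine ⟨k ^ (2 * (d + 1)), ?_⟩
  have h1 := hn₀ (k ^ (2 * (d + 1)))
    ((le_max_left _ _).trans (Nat.le_self_pow (by omega) k))
  rw [Nat.cast_pow, Real.pow_rpow_inv_natCast (by positivity) (by omega)] at h1
  have h2 : t (k ^ (2 * (d + 1))) ≤ k := by exact_mod_cast h1
  calc f (t (k ^ (2 * (d + 1))) + 1) ≤ (t (k ^ (2 * (d + 1))) + 1 + 2) ^ d := hd _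
    _ ≤ (k ^ 2) ^ d := Nat.pow_le_pow_left (by nlinarith) d
    _ ≤ (k ^ 2) ^ (d + 1) := Nat.pow_le_pow_right (by positivity) (by omega)
    _ = k ^ (2 * (d + 1)) := (pow_mul _ _ _).symm

/-- Otherwise `B.ncard` strict inclusions starting from a nonempty set would produce more elements
than `B` has. -/
theorem exists_eq_succ_of_bounded {X : Type*} {B : Set X} (hB : B.Finite) {s : ℕ → Set X}
    (hmono : ∀ q < B.ncard, s q ⊆ s (q + 1)) (hsub : ∀ q ≤ B.ncard, s q ⊆ B)
    (h0 : (s 0).Nonempty) : ∃ q < B.ncard, s q = s (q + 1) := by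
  by_contra! h
  have key : ∀ q ≤ B.ncard, q + 1 ≤ (s q).ncard := by
    intro q
    induction q with
    | zero => intro _; exact (Set.ncard_pos (hB.subset (hsub 0 (Nat.zero_le _)))).2 h0
    | succ q ih =>
      intro hq
      have h1 := ih (by omega)
      have h2 := Set.ncard_lt_ncard ((hmono q (by omega)).ssubset_of_ne (h q (by omega)))
        (hB.subset (hsub (q + 1) hq))
      omega
  have h1 := key B.ncard le_rfl
  have h2 := Set.ncard_le_ncard (hsub B.ncard le_rfl) hB
  omega

/-- The sizes of the trees in which configurations are collected. -/
def sizeBound (L T K : ℕ) : ℕ → ℕ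
  | 0 => K
  | q + 1 => 2 * sizeBound L T K q + 2 * (sizeBound L T K q + 2 * L + 4 * T + 4) * K

theorem sizeBound_mono (L T K : ℕ) : Monotone (sizeBound L T K) :=
  monotone_nat_of_le_succ fun q => by simp only [sizeBound]; nlinarith

theorem polyBounded_sizeBound {L K : ℕ → ℕ} (hL : PolyBounded L) (hK : PolyBounded K) (q : ℕ) :
    PolyBounded fun T => sizeBound (L T) T (K T) q := by
  induction q with
  | zero => exact hK
  | succ q ih =>
    exact ((PolyBounded.const 2).mul ih).add (((PolyBounded.const 2).mul
      (((ih.add ((PolyBounded.const 2).mul hL)).add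
        ((PolyBounded.const 4).mul PolyBounded.id)).add (PolyBounded.const 4))).mul hK)

/-! ### Basic properties of `coreConfigs` -/

namespace Word

variable {Δ : ℕ} {Λ : Type*}

theorem coreConfigs_mono (hΔ : 1 ≤ Δ) (A : LocalAlgorithm Λ) (n t : ℕ) (σ : Fin Δ → Fin Δ)
    {i i' N N' : ℕ} (hi : i' ≤ i) (hN : N ≤ N') :
    coreConfigs A n t σ i N ⊆ coreConfigs A n t σ i' N' := by
  rintro c ⟨U, ident, v, h1, h2, h3, h4, h5, h6⟩
  exact ⟨U, ident, v, h1, h2.trans hN, h3, h4,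
    (core_subset_core ⟨0, hΔ⟩ hi v).trans h5, h6⟩

theorem coreConfigs_nonempty (hΔ : 1 ≤ Δ) (A : LocalAlgorithm Λ) {n t : ℕ} {σ : Fin Δ → Fin Δ}
    {i N : ℕ} (hN : (core σ (t + 1) i nil).card ≤ N) (hn : N ≤ n) :
    (coreConfigs A n t σ i N).Nonempty := by
  obtain ⟨g, -, h1, h2, -⟩ := exists_injOn_extend (A := ∅) (B := core σ (t + 1) i nil) (n := n)
    (f := fun _ => 0) (F := ∅) (Finset.empty_subset _) (by simp) (by simp) (by simp; omega)
  exact ⟨_, _, g, nil, isConn_core ⟨0, hΔ⟩ i nil, hN, h1, h2, subset_rfl, rfl⟩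

theorem coreConfigs_subset {P : LCL Δ Λ} {A : LocalAlgorithm Λ} {t : ℕ → ℕ} {C : ℕ}
    (hC : 1 ≤ C) (hA : A.Solves t C P) (hΔ : 2 ≤ Δ) {σ : Fin Δ → Fin Δ} (hσ : ∀ α, σ α ≠ α)
    {n i N : ℕ} (hi : 1 ≤ i) (hn : N ≤ n) :
    coreConfigs A n (t n) σ i N ⊆ P.vertexConfigs := by
  rintro c ⟨U, ident, v, h1, h2, h3, h4, h5, rfl⟩
  exact (config_mem_of_core hC hA hΔ hσ h1 (h2.trans hn) h3 h4 hi h5).1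

end Word

theorem LCL.finite_vertexConfigs {Δ : ℕ} {Λ : Type*} [Finite Λ] (P : LCL Δ Λ) :
    P.vertexConfigs.Finite := by
  classical
  have := Fintype.ofFinite Λ
  have hfin : Finite {c : Multiset Λ // Multiset.card c = Δ} :=
    inferInstanceAs (Finite (Sym Λ Δ))
  have hset : {c : Multiset Λ | Multiset.card c = Δ}.Finite := hfin
  exact hset.subset P.card_of_mem

end RegTreeLCL

/-! ### The main theorem -/

open RegTreeLCL RegTreeLCL.Word in
theorem theoremt {Δ : ℕ} (hΔ : 3 ≤ Δ) {Λ : Type*} [Finite Λ] (P : RegTreeLCL.LCL Δ Λ)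
    (hP : RegTreeLCL.InLocalSubpolynomial P) :
    ∃ ℓ : ℕ, 2 ≤ ℓ ∧ ∃ S : Set (Multiset Λ), S.Nonempty ∧ RegTreeLCL.IsFull P S ℓ := by
  obtain ⟨t, ht, C, hC, A, hA⟩ := hP
  replace hA : A.Solves t C P := hA
  obtain ⟨σ, hσ⟩ : ∃ σ : Fin Δ → Fin Δ, ∀ α, σ α ≠ α := by
    have : Nontrivial (Fin Δ) := Fin.nontrivial_iff_two_le.2 (by omega)
    exact ⟨fun α => (exists_ne α).choose, fun α => (exists_ne α).choose_spec⟩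
  set M := P.vertexConfigs.ncard with hM
  have hL : PolyBounded fun T => 2 ^ (M + 1) * T := (PolyBounded.const _).mul PolyBounded.id
  have hK : PolyBounded fun T => (Δ * (2 ^ (M + 1) * T + 1)) ^ (M + 1) :=
    ((PolyBounded.const Δ).mul (hL.add (PolyBounded.const 1))).pow _
  -- The factor `3` leaves room for the identifiers of a glued tree and of the neighbourhoods of its
  -- two ends.
  obtain ⟨n, hn⟩ := ht.exists_le
    ((PolyBounded.const 3).mul (polyBounded_sizeBound hL hK M))
  set T := t n + 1 with hT
  set L := 2 ^ (M + 1) * T with hLdef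
  set K := (Δ * (L + 1)) ^ (M + 1) with hKdef
  let N := sizeBound L T K
  have hNmono : Monotone N := sizeBound_mono L T K
  have hNn : 3 * N M ≤ n := hn
  have hcard : ∀ i ≤ M + 1, ∀ v, (core σ T i v).card ≤ K := fun i hi v =>
    (card_core_le hi v).trans (Nat.pow_le_pow_right (by positivity) hi)
  -- For `q ≤ M` the level `M + 1 - q` is at least `1`, as validity of the configurations requires.
  let s : ℕ → Set (Multiset Λ) := fun q => coreConfigs A n (t n) σ (M + 1 - q) (N q)
  have hsub : ∀ q ≤ M, s q ⊆ P.vertexConfigs := fun q hq =>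
    coreConfigs_subset hC hA (by omega) hσ (by omega) (by have := hNmono hq; omega)
  have hs0 : (s 0).Nonempty :=
    coreConfigs_nonempty (by omega) A (hcard _ le_rfl nil)
      (by have := hNmono (Nat.zero_le M); omega)
  have hmono : ∀ q, s q ⊆ s (q + 1) := fun q =>
    coreConfigs_mono (by omega) A n (t n) σ (by omega) (hNmono (Nat.le_succ q))
  obtain ⟨q, hq, hqs⟩ := exists_eq_succ_of_bounded P.finite_vertexConfigs
    (fun q _ => hmono q) hsub hs0
  have hne : (s (q + 1)).Nonempty := hs0.mono (monotone_nat_of_le_succ hmono (Nat.zero_le _))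
  -- This `ℓ` is the least path length admitted by `linkable_coreConfigs`, with `L` bounding all the
  -- core path lengths. The recursion of `sizeBound` adds `2 * ℓ * K`, which pays for a core at each
  -- of at most `2 * ℓ` path vertices.
  refine ⟨N q + 2 * L + 4 * T + 4, by omega, s (q + 1), hne, ?_⟩
  refine isFull_of_linkable (hsub _ hq) (linkable_of_bounded (by omega) (hsub _ hq) hne
    (by omega) ?_)
  intro m hm1 hm2 c₁ hc₁ c₂ hc₂ a ha b hb
  rw [← hqs] at hc₁ hc₂
  have hi : M + 1 - q = M + 1 - (q + 1) + 1 := by omega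
  simp only [s] at hc₁ hc₂
  rw [hi] at hc₁ hc₂
  have hpow : 2 ^ (M + 1 - (q + 1)) * T ≤ L :=
    Nat.mul_le_mul_right T (Nat.pow_le_pow_right (by omega) (by omega))
  refine linkable_coreConfigs hC hA hΔ hσ (by omega) (hcard _ (by omega)) ?_ ?_ ?_ hc₁ hc₂ ha hb
  · rw [← hT]; omega
  · have h1 : (m + 2) * K ≤ 2 * (N q + 2 * L + 4 * T + 4) * K := Nat.mul_le_mul_right K hm2
    exact Nat.add_le_add_left h1 (2 * N q)
  · have h1 : N (q + 1) ≤ N M := hNmono hq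
    have h2 : N q ≤ N M := hNmono hq.le
    change N (q + 1) + 2 * N q ≤ n
    omega
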